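/- **Model.** Fix $c_{\min}\in(0,1/2)$. Let $Z\in\{0,1\}^{n\times K}$ be a community membership matrix (exactly one $1$ in each row) and let $\mathbf W^t,\mathbf M^t\in[c_{\min},1-c_{\min}]^{K\times K\times L}$ for $t\ge1$. For $1\le i\le j\le n$ and $l\in[L]$ put $\Theta^t_{i,j,l}=Z_i\mathbf W^t_{:,:,l}Z_j^\top$ and $\Delta^t_{i,j,l}=Z_i\mathbf M^t_{:,:,l}Z_j^\top$. Let $E^t_{i,j,l}\in\{-1,0,1\}$ ($t\ge 1$, $i\le j$, $l\in[L]$) be mutually independent with $P(E^t_{i,j,l}=1)=\Theta^t_{i,j,l}$, $P(E^t_{i,j,l}=-1)=\Delta^t_{i,j,l}$ and $P(E^t_{i,j,l}=0)=1-\Theta^t_{i,j,l}-\Delta^t_{i,j,l}$. Let $A^0_{i,j,l}\in\{0,1\}$ with $c_{\min}\le \mathbb E A^0_{i,j,l}\le 1-c_{\min}$ and $$A^t_{i,j,l}=A^{t-1}_{i,j,l}\mathbf 1\{E^t_{i,j,l}=0\}+\mathbf 1\{E^t_{i,j,l}=1\},\qquad t\ge1 .$$ The networks are undirected, so all tensors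 are determined by their entries with $i\le j$, and $\|\cdot\|_\infty$ is the maximum over these entries. **Drift and segments.** Let $V:(0,\infty)\to(0,\infty)$ be non-increasing with $|\log V(x)-\log V(y)|\le C_{\mathrm{Lip}}|\log x-\log y|$ for all $x,y>0$, where $C_{\mathrm{Lip}}>0$. For a real sequence $(u_t)$ let $p_{s,e}=\sum_{t=s}^{e-1}(u_{t+1}-u_t)_+$ and $n_{s,e}=\sum_{t=s}^{e-1}(u_{t+1}-u_t)_-$. The sequence $u_1,\dots,u_p$ is *dominantly monotone* if for some $C_\alpha\in[0,1)$ one has $n_{1,p}\le C_\alpha p_{1,p}$ or $p_{1,p}\le C_\alpha n_{1,p}$; it is *locally dominantly monotone* if for some $C_\alpha\in[0,c_{\min}(1-c_{\min})^{-1})$ and every $1\le s<e\le p$ one has $n_{s,e}\le C_\alpha p_{s,e}$ or $p_{s,e}\le C_\alpha n_{s,e}$. Suppose that $0=T_0<T_1<\dots<T_G=T$ splits $(\Theta^t,\Delta^t)_{t=1}^T$ into $G$ *$V$-quasi-stationary segments*: for every $g\in[G]$ and all $s,u\in(T_{g-1},T_g]$, $\|\Theta^s-\Theta^u\|_\infty+\|\Delta^s-\Delta^u\|_\infty\le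 V(T_g-T_{g-1})$; for every $(i,j,l)$ the sequences $(\Theta^{T_{g-1}+1}_{i,j,l})_{g\in[G]}$ and $(\Delta^{T_{g-1}+1}_{i,j,l})_{g\in[G]}$ are locally dominantly monotone; and within each segment the sequences $(\Theta^t_{i,j,l})$ and $(\Delta^t_{i,j,l})$ are dominantly monotone. **Estimator.** For $1\le k\le t$ let, entrywise, $$\widehat\Theta^{t,k}=\frac{\sum_{u=t-k+1}^tA^u(1-A^{u-1})}{\sum_{u=t-k+1}^t(1-A^{u-1})},\qquad \widehat\Delta^{t,k}=\frac{\sum_{u=t-k+1}^t(1-A^u)A^{u-1}}{\sum_{u=t-k+1}^tA^{u-1}}\qquad(0/0:=0),$$ and let $f^{t,k}$ be the averaged negative log-likelihood, with entries (using $0\log0=0$) $$f^{t,k}(\theta,\delta)=-\frac1k\sum_{u=t-k+1}^t\big\{A^u(1-A^{u-1})\log\theta+(1-A^u)(1-A^{u-1})\log(1-\theta)+(1-A^u)A^{u-1}\log\delta+A^uA^{u-1}\log(1-\delta)\big\}.$$ Let $\mathcal G^{(1)}=\{1\}$ and, for $t\ge2$, $$\mathcal G^{(t)}=\{1\}\cup\bigcup_{j=1}^{\lfloor\log_2\{(t-1)/3\}\rfloor+1}\{\mathcal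 G^{(t)}_{\mathrm L,j}\}\cup\bigcup_{j=1}^{\lfloor\log_2(t-1)\rfloor-1}\{\mathcal G^{(t)}_{\mathrm L,j}+2^{j-1}\},\qquad \mathcal G^{(t)}_{\mathrm L,j}=2^j+\{(t-1)\bmod 2^{j-1}\}.$$ Let $\tau(k)=C_\tau\max\{k^{-1}\log(n\vee L\vee T)\log(T)\log\log(T),\,V(k)^2\}$. A candidate $q\in\mathcal G^{(t)}$ passes if $\|f^{t,u}(\widehat\Theta^{t,q},\widehat\Delta^{t,q})-f^{t,u}(\widehat\Theta^{t,u},\widehat\Delta^{t,u})\|_\infty\le\tau(u)$ for all $u\in\mathcal G^{(t)}$ with $u\le q$. Test the candidates in increasing order until the first one fails; $\hat k_t$ is the last candidate before that failure, or $\max\mathcal G^{(t)}$ if none fails. **Theorem.** There is $C_0>0$, depending only on $c_{\min}$ and $C_{\mathrm{Lip}}$, such that for every $C_\tau\ge C_0$ there are $C,c>0$, depending only on $c_{\min},C_{\mathrm{Lip}},C_\tau$, such that in the above setting, for all $n,L,K,G$ and all $T\ge3$, with probability at least $1-(n\vee L\vee T)^{-c}$, $$|\widehat\Theta^{t,\hat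 k_t}_{i,j,l}-\Theta^t_{i,j,l}|^2+|\widehat\Delta^{t,\hat k_t}_{i,j,l}-\Delta^t_{i,j,l}|^2\le C\max\Big\{\frac{\log(n\vee L\vee T)\log(T)\log\log(T)}{t-T_{g-1}},\;V(t-T_{g-1})^2\Big\}$$ simultaneously for all $1\le i\le j\le n$, $l\in[L]$, $g\in[G]$ and $T_{g-1}<t\le T_g$. -/

import Mathlib

open MeasureTheory ProbabilityTheory

noncomputable section

namespace ARMSBM

/-- Edge-layer positions `(i, j, l)` with `i ≤ j`. The network is undirected, so an `n × n × L`
tensor attached to it is determined by these entries; a tensor is a function `Edge n L → ℝ`, and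
its norm `‖·‖` in Lean is the entrywise maximum norm `‖·‖_∞`. -/
abbrev Edge (n L : ℕ) : Type := {e : Fin n × Fin n × Fin L // e.1 ≤ e.2.1}

/-- `Z` is a community membership matrix: entries in `{0, 1}` and exactly one `1` in every row. -/
def IsMembership {n K : ℕ} (Z : Matrix (Fin n) (Fin K) ℝ) : Prop :=
  (∀ i k, Z i k = 0 ∨ Z i k = 1) ∧ ∀ i, ∃! k, Z i k = 1

/-- The tensor with entries `Z_i W_{:,:,l} Z_jᵀ`. -/
def blockTensor {n L K : ℕ} (Z : Matrix (Fin n) (Fin K) ℝ)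
    (W : Fin K → Fin K → Fin L → ℝ) : Edge n L → ℝ :=
  fun e => ∑ a, ∑ b, Z e.1.1 a * W a b e.1.2.2 * Z e.1.2.1 b

/-- The process `A` (with innovations `E`) is a non-stationary first-order autoregressive
multilayer stochastic block model with memberships `Z` and connectivity tensors `W t`, `M t`.
Innovations and connectivity tensors at time `0` play no role. -/
structure IsNonstatARMSBM {Ω : Type*} [MeasurableSpace Ω] (μ : Measure Ω) {n L K : ℕ}
    (cmin : ℝ) (Z : Matrix (Fin n) (Fin K) ℝ) (W M : ℕ → Fin K → Fin K → Fin L → ℝ)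
    (E : ℕ → Edge n L → Ω → ℤ) (A : ℕ → Edge n L → Ω → ℝ) : Prop where
  membership : IsMembership Z
  connectivity_W : ∀ t, 1 ≤ t → ∀ a b l, W t a b l ∈ Set.Icc cmin (1 - cmin)
  connectivity_M : ∀ t, 1 ≤ t → ∀ a b l, M t a b l ∈ Set.Icc cmin (1 - cmin)
  measurable_E : ∀ t, 1 ≤ t → ∀ e, Measurable (E t e)
  values_E : ∀ t, 1 ≤ t → ∀ e ω, E t e ω = -1 ∨ E t e ω = 0 ∨ E t e ω = 1
  indep_E : iIndepFun (fun p : ℕ × Edge n L => E (p.1 + 1) p.2) μ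
  prob_one : ∀ t, 1 ≤ t → ∀ e, μ.real {ω | E t e ω = 1} = blockTensor Z (W t) e
  prob_neg_one : ∀ t, 1 ≤ t → ∀ e, μ.real {ω | E t e ω = -1} = blockTensor Z (M t) e
  prob_zero : ∀ t, 1 ≤ t → ∀ e,
    μ.real {ω | E t e ω = 0} = 1 - blockTensor Z (W t) e - blockTensor Z (M t) e
  measurable_A_zero : ∀ e, Measurable (A 0 e)
  values_A_zero : ∀ e ω, A 0 e ω = 0 ∨ A 0 e ω = 1
  mean_A_zero : ∀ e, ∫ ω, A 0 e ω ∂μ ∈ Set.Icc cmin (1 - cmin)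
  recursion : ∀ t e ω, A (t + 1) e ω =
    A t e ω * (if E (t + 1) e ω = 0 then 1 else 0) + (if E (t + 1) e ω = 1 then 1 else 0)

/-! ### Segmentation -/

/-- Total upward variation `p_{s,e}` of the sequence `u` between the indices `s` and `e`. -/
def upVar (u : ℕ → ℝ) (s e : ℕ) : ℝ := ∑ t ∈ Finset.Ico s e, max (u (t + 1) - u t) 0

/-- Total downward variation `n_{s,e}` of the sequence `u` between the indices `s` and `e`. -/
def downVar (u : ℕ → ℝ) (s e : ℕ) : ℝ := ∑ t ∈ Finset.Ico s e, max (-(u (t + 1) - u t)) 0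

/-- The finite sequence `u_s, …, u_e` is dominantly monotone. -/
def DominantlyMonotone (u : ℕ → ℝ) (s e : ℕ) : Prop :=
  ∃ Ca : ℝ, 0 ≤ Ca ∧ Ca < 1 ∧
    (downVar u s e ≤ Ca * upVar u s e ∨ upVar u s e ≤ Ca * downVar u s e)

/-- The finite sequence `u_1, …, u_p` is locally dominantly monotone. -/
def LocallyDominantlyMonotone (cmin : ℝ) (u : ℕ → ℝ) (p : ℕ) : Prop :=
  ∃ Ca : ℝ, 0 ≤ Ca ∧ Ca < cmin * (1 - cmin)⁻¹ ∧ ∀ s e, 1 ≤ s → s < e → e ≤ p →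
    (downVar u s e ≤ Ca * upVar u s e ∨ upVar u s e ≤ Ca * downVar u s e)

/-- The time points `0 = τ 0 < τ 1 < ⋯ < τ G = T` split the sequence `(Θ t, Δ t)`, `1 ≤ t ≤ T`,
into `G` `V`-quasi-stationary segments; segment `g ∈ {1, …, G}` is `{τ (g-1) + 1, …, τ g}`. -/
structure IsQuasiStationary {n L : ℕ} (cmin : ℝ) (V : ℝ → ℝ) (T G : ℕ) (τ : ℕ → ℕ)
    (Θ Δ : ℕ → Edge n L → ℝ) : Prop where
  one_le : 1 ≤ G
  zero : τ 0 = 0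
  last : τ G = T
  lt : ∀ g ∈ Finset.Icc 1 G, τ (g - 1) < τ g
  drift : ∀ g ∈ Finset.Icc 1 G,
    ∀ s ∈ Finset.Ioc (τ (g - 1)) (τ g), ∀ u ∈ Finset.Ioc (τ (g - 1)) (τ g),
      ‖Θ s - Θ u‖ + ‖Δ s - Δ u‖ ≤ V ((τ g : ℝ) - τ (g - 1))
  starts_Theta : ∀ e, LocallyDominantlyMonotone cmin (fun g => Θ (τ (g - 1) + 1) e) G
  starts_Delta : ∀ e, LocallyDominantlyMonotone cmin (fun g => Δ (τ (g - 1) + 1) e) G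
  within_Theta : ∀ g ∈ Finset.Icc 1 G, ∀ e,
    DominantlyMonotone (fun t => Θ t e) (τ (g - 1) + 1) (τ g)
  within_Delta : ∀ g ∈ Finset.Icc 1 G, ∀ e,
    DominantlyMonotone (fun t => Δ t e) (τ (g - 1) + 1) (τ g)

/-- The drift function `V : (0, ∞) → (0, ∞)` is non-increasing and log-log Lipschitz with
constant `CLip`. -/
structure IsDriftFunction (CLip : ℝ) (V : ℝ → ℝ) : Prop where
  pos : ∀ x, 0 < x → 0 < V x
  antitone : ∀ x y, 0 < x → x ≤ y → V y ≤ V x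
  lipschitz : ∀ x y, 0 < x → 0 < y →
    |Real.log (V x) - Real.log (V y)| ≤ CLip * |Real.log x - Real.log y|

/-! ### The adaptive windowed estimator, as a function of an observed path `a` -/

/-- Left grid point `2^j + ((t-1) mod 2^(j-1))`. -/
def gridL (t j : ℕ) : ℕ := 2 ^ j + (t - 1) % 2 ^ (j - 1)

/-- Right grid point `2^j + ((t-1) mod 2^(j-1)) + 2^(j-1)`. -/
def gridR (t j : ℕ) : ℕ := gridL t j + 2 ^ (j - 1)

/-- The dynamic geometric grid of candidate windows at time `t`; at time `1` the only possible
window is `1`. An upper limit of the union below `1` means an empty union. -/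
def grid (t : ℕ) : Finset ℕ :=
  if t ≤ 1 then {1} else
    {1} ∪ (Finset.Icc 1 (⌊Real.logb 2 (((t : ℝ) - 1) / 3)⌋ + 1).toNat).image (gridL t)
      ∪ (Finset.Icc 1 (⌊Real.logb 2 ((t : ℝ) - 1)⌋ - 1).toNat).image (gridR t)

variable {n L : ℕ}

/-- Cumulative number of `0 → 1` transitions. -/
def count01 (a : ℕ → Edge n L → ℝ) : ℕ → Edge n L → ℝ
  | 0 => 0
  | t + 1 => count01 a t + a (t + 1) * (1 - a t)

/-- Cumulative number of `1 → 0` transitions. -/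
def count10 (a : ℕ → Edge n L → ℝ) : ℕ → Edge n L → ℝ
  | 0 => 0
  | t + 1 => count10 a t + (1 - a (t + 1)) * a t

/-- Cumulative number of active edges. -/
def countActive (a : ℕ → Edge n L → ℝ) : ℕ → Edge n L → ℝ
  | 0 => 0
  | t + 1 => countActive a t + a t

/-- Windowed maximum likelihood estimator of `Θ` at time `t` with look-back window `k ≤ t`
(`0 / 0 = 0`; the likelihood does not depend on the entry when its denominator vanishes). -/
def thetaHat (a : ℕ → Edge n L → ℝ) (t k : ℕ) : Edge n L → ℝ := fun e =>
  (count01 a t e - count01 a (t - k) e) / ((k : ℝ) - (countActive a t e - countActive a (t - k) e))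

/-- Windowed maximum likelihood estimator of `Δ` at time `t` with look-back window `k ≤ t`. -/
def deltaHat (a : ℕ → Edge n L → ℝ) (t k : ℕ) : Edge n L → ℝ := fun e =>
  (count10 a t e - count10 a (t - k) e) / (countActive a t e - countActive a (t - k) e)

/-- Averaged negative log-likelihood `f^{t,k}`, entry by entry. It is only evaluated below at
estimators from windows containing the last `k` steps; there a logarithm of `0` always has
coefficient `0`. -/
def loss (a : ℕ → Edge n L → ℝ) (t k : ℕ) (θ δ : Edge n L → ℝ) : Edge n L → ℝ := fun e =>
  -(1 / (k : ℝ)) * ∑ u ∈ Finset.Icc (t - k + 1) t,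
    (a u e * (1 - a (u - 1) e) * Real.log (θ e)
      + (1 - a u e) * (1 - a (u - 1) e) * Real.log (1 - θ e)
      + (1 - a u e) * a (u - 1) e * Real.log (δ e)
      + a u e * a (u - 1) e * Real.log (1 - δ e))

/-- The stability test for the candidate window `q` at time `t` with tolerances `tol`. -/
def Passes (a : ℕ → Edge n L → ℝ) (tol : ℕ → ℝ) (t q : ℕ) : Prop :=
  ∀ u ∈ grid t, u ≤ q →
    ‖loss a t u (thetaHat a t q) (deltaHat a t q) - loss a t u (thetaHat a t u) (deltaHat a t u)‖
      ≤ tol u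

open Classical in
/-- The selected window: candidates are tested in increasing order until the first one fails,
and the last candidate before that failure (or the largest candidate, if none fails) is kept.
For nonnegative tolerances the candidate `1` always passes. -/
def selectedWindow (a : ℕ → Edge n L → ℝ) (tol : ℕ → ℝ) (t : ℕ) : ℕ :=
  ((grid t).filter (fun k => ∀ q ∈ grid t, q ≤ k → Passes a tol t q)).sup id

/-- The stochastic factor `log (n ∨ L ∨ T) · log T · log log T`. -/
def logFactor (n L T : ℕ) : ℝ :=
  Real.log ((max n (max L T) : ℕ) : ℝ) * Real.log T * Real.log (Real.log T)

/-- The tolerance `Ctau · max {t⁻¹ log (n ∨ L ∨ T) log T log log T, V(t)²}`. -/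
def tolerance (Ctau : ℝ) (V : ℝ → ℝ) (n L T : ℕ) (t : ℕ) : ℝ :=
  Ctau * max ((t : ℝ)⁻¹ * logFactor n L T) (V t ^ 2)

end ARMSBM

end

/-! The upper bound is a bias-variance argument in which the likelihood test serves as a proxy for
squared distance.

Reduction. Entry by entry, the loss splits into two binomial losses: one for the `0 → 1` transitions
of the edge path, one for those of its complement. The complement is the same kind of process with
the innovations negated, so every estimate is proved once, for a path `β` with upward rates `ρ`, and
applied twice. The excess of a binomial loss over its minimum is the number of trials times a
Bernoulli Kullback-Leibler divergence, hence comparable to the squared difference of rates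
(`binLoss_sub_ge`, `binLoss_sub_le`).

Probability. With `N = n ∨ L ∨ T` and `ℓ = log N`, Hoeffding's lemma for predictably weighted sums
and a union bound over edges and windows show that outside an event of probability at most `1 / N`
all paths are typical (`IsTypicalPath`): over `k` steps the noise has squared size at most `5 ℓ k`,
and long windows visit `0` a positive fraction of the time. The rest is deterministic.

Selection (`selected_error_le`). Let `m` be the time elapsed in the current segment. Every candidate
`q ≤ m` passes, since on each subwindow its excess loss is at most noise plus drift
(`excessLoss_le`). The grid contains some `k ≤ m ≤ 4 k`, so the selected window is at least `k`. It
may reach far into earlier segments, but it has passed the test against `k`; the quadratic lower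
bound then places its estimate near that of window `k`, which is near the current parameter
(`rate_sub_sq_le_of_excessLoss`). Passing from `k` to `m` costs a constant, by the log-log Lipschitz
property of `V`. -/

namespace ARMSBM

/-! ### The binomial negative log-likelihood -/

/-- Negative log-likelihood of `θ` for `x` successes and `y` failures. -/
noncomputable def binLoss (x y θ : ℝ) : ℝ := -(x * Real.log θ + y * Real.log (1 - θ))

/-- Apply `log x ≤ x - 1` at `x = √θ / √p`. The hypothesis `h` excludes the case where the
convention `log 0 = 0` would replace an infinite loss by `0`. -/
lemma mul_log_sub_le_sqrt {p θ : ℝ} (hp : 0 ≤ p) (h : 0 < p → 0 < θ) :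
    p * Real.log θ - p * Real.log p ≤ 2 * (√p * √θ - p) := by
  rcases hp.eq_or_lt with rfl | hp
  · simp
  have hθ := h hp
  have h1 := Real.log_le_sub_one_of_pos (div_pos (Real.sqrt_pos.2 hθ) (Real.sqrt_pos.2 hp))
  rw [Real.log_div (Real.sqrt_pos.2 hθ).ne' (Real.sqrt_pos.2 hp).ne', Real.log_sqrt hθ.le,
    Real.log_sqrt hp.le] at h1
  have h2 : p * (√θ / √p) = √p * √θ := by
    rw [mul_div_assoc', div_eq_iff (Real.sqrt_pos.2 hp).ne']
    linear_combination (-√θ) * Real.mul_self_sqrt hp.le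
  nlinarith [mul_le_mul_of_nonneg_left h1 hp.le]

lemma sub_sq_le_sqrt_sub_sq {p θ : ℝ} (hp : 0 ≤ p) (hp1 : p ≤ 1) (hθ : 0 ≤ θ) (hθ1 : θ ≤ 1) :
    (θ - p) ^ 2 ≤ 4 * (√p - √θ) ^ 2 := by
  have h1 : √p ≤ 1 := Real.sqrt_le_one.2 hp1
  have h2 : √θ ≤ 1 := Real.sqrt_le_one.2 hθ1
  have h3 : (θ - p) ^ 2 = (√p + √θ) ^ 2 * (√p - √θ) ^ 2 := by
    rw [← mul_pow, ← sq_sub_sq, Real.sq_sqrt hp, Real.sq_sqrt hθ]; ring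
  have h4 : (√p + √θ) ^ 2 ≤ 4 := by nlinarith [Real.sqrt_nonneg p, Real.sqrt_nonneg θ]
  rw [h3]
  exact mul_le_mul_of_nonneg_right h4 (sq_nonneg _)

/-- The divergence dominates `(√p - √θ)² + (√(1-p) - √(1-θ))²`, and each of these squares is at
least `(θ - p)² / 4`. Passing through this Hellinger distance allows rates equal to `0` or `1`. -/
lemma bernoulli_kl_ge {p θ : ℝ} (hp : 0 ≤ p) (hp1 : p ≤ 1) (hθ : 0 ≤ θ) (hθ1 : θ ≤ 1)
    (h0 : 0 < p → 0 < θ) (h1 : 0 < 1 - p → θ < 1) :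
    (θ - p) ^ 2 / 2 ≤ binLoss p (1 - p) θ - binLoss p (1 - p) p := by
  have a := mul_log_sub_le_sqrt hp h0
  have b := mul_log_sub_le_sqrt (sub_nonneg.2 hp1) (θ := 1 - θ) fun h => sub_pos.2 (h1 h)
  have c := sub_sq_le_sqrt_sub_sq hp hp1 hθ hθ1
  have d := sub_sq_le_sqrt_sub_sq (p := 1 - p) (θ := 1 - θ) (by linarith) (by linarith)
    (by linarith) (by linarith)
  have e := Real.sq_sqrt hp
  have f := Real.sq_sqrt hθ
  have g := Real.sq_sqrt (sub_nonneg.2 hp1)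
  have i := Real.sq_sqrt (sub_nonneg.2 hθ1)
  unfold binLoss
  nlinarith

/-- The right side is the chi-square divergence, which dominates Kullback-Leibler by `log x ≤ x -
1`. -/
lemma bernoulli_kl_le {p θ : ℝ} (hp : 0 ≤ p) (hp1 : p ≤ 1) (hθ : 0 < θ) (hθ1 : θ < 1) :
    binLoss p (1 - p) θ - binLoss p (1 - p) p ≤ (θ - p) ^ 2 / (θ * (1 - θ)) := by
  have key : ∀ {p θ : ℝ}, 0 ≤ p → 0 < θ → p * Real.log p - p * Real.log θ ≤ p * (p / θ - 1) := by
    intro p θ hp hθ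
    rcases hp.eq_or_lt with rfl | hp
    · simp
    rw [← mul_sub, ← Real.log_div hp.ne' hθ.ne']
    exact mul_le_mul_of_nonneg_left (Real.log_le_sub_one_of_pos (div_pos hp hθ)) hp.le
  have a := key hp hθ
  have b := key (sub_nonneg.2 hp1) (sub_pos.2 hθ1)
  have h1θ : 1 - θ ≠ 0 := (sub_pos.2 hθ1).ne'
  have c : (θ - p) ^ 2 / (θ * (1 - θ)) = p * (p / θ - 1) + (1 - p) * ((1 - p) / (1 - θ) - 1) := by
    field_simp
    ring
  unfold binLoss
  linarith

lemma binLoss_eq_mul {x y : ℝ} (hD : x + y ≠ 0) (θ : ℝ) :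
    binLoss x y θ = (x + y) * binLoss (x / (x + y)) (1 - x / (x + y)) θ := by
  unfold binLoss
  field_simp
  ring

lemma rate_mem {x y : ℝ} (hx : 0 ≤ x) (hy : 0 ≤ y) : 0 ≤ x / (x + y) ∧ x / (x + y) ≤ 1 :=
  ⟨by positivity, div_le_one_of_le₀ (by linarith) (by linarith)⟩

/-- Quadratic lower bound for the excess loss over the maximum likelihood estimate. -/
lemma binLoss_sub_ge {x y θ : ℝ} (hx : 0 ≤ x) (hy : 0 ≤ y) (hθ : 0 ≤ θ) (hθ1 : θ ≤ 1)
    (h0 : 0 < x → 0 < θ) (h1 : 0 < y → θ < 1) :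
    (x + y) * (θ - x / (x + y)) ^ 2 / 2 ≤ binLoss x y θ - binLoss x y (x / (x + y)) := by
  rcases (add_nonneg hx hy).eq_or_lt with hD | hD
  · have hx0 : x = 0 := by linarith
    have hy0 : y = 0 := by linarith
    simp [hx0, hy0, binLoss]
  obtain ⟨hp, hp1⟩ := rate_mem hx hy
  have hx' : 0 < x / (x + y) → 0 < θ := fun h => h0 (by
    rcases hx.eq_or_lt with rfl | h'
    · simp at h
    · exact h')
  have hy' : 0 < 1 - x / (x + y) → θ < 1 := fun h => h1 (by
    rcases hy.eq_or_lt with rfl | h'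
    · rw [add_zero] at h hD
      simp [hD.ne'] at h
    · exact h')
  rw [binLoss_eq_mul hD.ne' θ, binLoss_eq_mul hD.ne' (x / (x + y)), ← mul_sub, mul_div_assoc]
  exact mul_le_mul_of_nonneg_left (bernoulli_kl_ge hp hp1 hθ hθ1 hx' hy') hD.le

/-- Quadratic upper bound for the excess loss over the maximum likelihood estimate. -/
lemma binLoss_sub_le {x y θ : ℝ} (hx : 0 ≤ x) (hy : 0 ≤ y) (hθ : 0 < θ) (hθ1 : θ < 1) :
    binLoss x y θ - binLoss x y (x / (x + y))
      ≤ (x + y) * ((θ - x / (x + y)) ^ 2 / (θ * (1 - θ))) := by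
  rcases (add_nonneg hx hy).eq_or_lt with hD | hD
  · have hx0 : x = 0 := by linarith
    have hy0 : y = 0 := by linarith
    simp [hx0, hy0, binLoss]
  obtain ⟨hp, hp1⟩ := rate_mem hx hy
  rw [binLoss_eq_mul hD.ne' θ, binLoss_eq_mul hD.ne' (x / (x + y)), ← mul_sub]
  exact mul_le_mul_of_nonneg_left (bernoulli_kl_le hp hp1 hθ hθ1) hD.le

lemma binLoss_nonneg {x y θ : ℝ} (hx : 0 ≤ x) (hy : 0 ≤ y) (hθ : 0 ≤ θ) (hθ1 : θ ≤ 1) :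
    0 ≤ binLoss x y θ := by
  have a := mul_nonpos_of_nonneg_of_nonpos hx (Real.log_nonpos hθ hθ1)
  have b := mul_nonpos_of_nonneg_of_nonpos hy
    (Real.log_nonpos (sub_nonneg.2 hθ1) (sub_le_self 1 hθ))
  unfold binLoss
  linarith

lemma neg_mul_log_div_le {x X D : ℝ} (hx : 0 ≤ x) (hX : x ≤ X) (hD : X ≤ D) :
    -(x * Real.log (X / D)) ≤ D := by
  rcases hx.eq_or_lt with rfl | hx
  · simpa using hX.trans hD
  have hX0 : 0 < X := hx.trans_le hX
  have hD0 : 0 < D := hX0.trans_le hD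
  have h := Real.log_le_sub_one_of_pos (div_pos hD0 hX0)
  rw [← inv_div, Real.log_inv] at h
  have h2 : x * ((X / D)⁻¹ - 1) ≤ X * ((X / D)⁻¹ - 1) := by
    apply mul_le_mul_of_nonneg_right hX
    rw [inv_div, sub_nonneg, le_div_iff₀ hX0]; linarith
  have h3 : X * ((X / D)⁻¹ - 1) = D - X := by field_simp
  nlinarith [mul_le_mul_of_nonneg_left h hx.le]

/-- Loss on a subsample of an estimate from a sample of size at most `Q`. -/
lemma binLoss_rate_le {x y X Y Q : ℝ} (hx : 0 ≤ x) (hy : 0 ≤ y) (hX : x ≤ X) (hY : y ≤ Y)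
    (hQ : X + Y ≤ Q) : binLoss x y (X / (X + Y)) ≤ 2 * Q := by
  rcases (add_nonneg (hx.trans hX) (hy.trans hY)).eq_or_lt with hD | hD
  · have hx0 : x = 0 := by linarith
    have hy0 : y = 0 := by linarith
    simp only [hx0, hy0, binLoss]
    linarith
  have a := neg_mul_log_div_le hx hX (D := X + Y) (by linarith)
  have b := neg_mul_log_div_le hy hY (D := X + Y) (by linarith)
  have c : 1 - X / (X + Y) = Y / (X + Y) := by field_simp; ring
  unfold binLoss
  rw [c]
  linarith

/-! ### Concentration of predictably weighted sums -/

/-- Indicator of the innovation `z` being equal to `v`. -/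
noncomputable def hit (v z : ℤ) : ℝ := if z = v then 1 else 0

lemma hit_nonneg (v z : ℤ) : 0 ≤ hit v z := by unfold hit; split_ifs <;> simp

lemma hit_le_one (v z : ℤ) : hit v z ≤ 1 := by unfold hit; split_ifs <;> simp

section Concentration

variable {Ω : Type*}

lemma integral_hit {mΩ : MeasurableSpace Ω} {μ : Measure Ω} {ξ : Ω → ℤ} (hξ : Measurable ξ)
    (v : ℤ) : ∫ ω, hit v (ξ ω) ∂μ = μ.real {ω | ξ ω = v} := by
  have h : (fun ω => hit v (ξ ω)) = Set.indicator {ω | ξ ω = v} 1 := by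
    ext ω
    simp [hit, Set.indicator_apply]
  rw [h, integral_indicator_one (measurableSet_eq_fun hξ measurable_const)]

lemma measurable_hit (v : ℤ) : Measurable (hit v) := measurable_from_top

lemma integral_exp_hit_le {mΩ : MeasurableSpace Ω} {μ : Measure Ω} [IsProbabilityMeasure μ]
    {ξ : Ω → ℤ} (hξ : Measurable ξ) (v : ℤ) (r : ℝ) :
    ∫ ω, Real.exp (r * (hit v (ξ ω) - μ.real {ω | ξ ω = v})) ∂μ ≤ Real.exp (r ^ 2 / 8) := by
  have h := (hasSubgaussianMGF_of_mem_Icc (μ := μ) (X := fun ω => hit v (ξ ω)) (a := 0) (b := 1)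
    ((measurable_hit v).comp hξ).aemeasurable
    (Filter.Eventually.of_forall fun ω => ⟨hit_nonneg _ _, hit_le_one _ _⟩)).mgf_le r
  rw [integral_hit hξ] at h
  refine h.trans (Real.exp_le_exp.2 ?_)
  simp
  linarith

/-- One step of the Azuma-Hoeffding induction. Since `w` is `0` or `1`, the new exponential is
exactly the old one where `w = 0` and the old one times an independent factor where `w = 1`, so
independence replaces conditional expectations. -/
lemma integral_exp_add_le {m mΩ : MeasurableSpace Ω} {μ : Measure Ω} [IsProbabilityMeasure μ]
    (hm : m ≤ mΩ) {ξ : Ω → ℤ} (hξ : Measurable ξ)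
    (hind : Indep m (MeasurableSpace.comap ξ ⊤) μ) {S w : Ω → ℝ} (hS : Measurable[m] S)
    (hw : Measurable[m] w) (hw01 : ∀ ω, w ω = 0 ∨ w ω = 1) {B : ℝ} (hB : ∀ ω, |S ω| ≤ B)
    (v : ℤ) (r : ℝ) :
    ∫ ω, Real.exp (r * (S ω + w ω * (hit v (ξ ω) - μ.real {ω | ξ ω = v}))) ∂μ
      ≤ Real.exp (r ^ 2 / 8) * ∫ ω, Real.exp (r * S ω) ∂μ := by
  set p := μ.real {ω | ξ ω = v}
  set X : Ω → ℝ := fun ω => Real.exp (r * (hit v (ξ ω) - p)) with hX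
  have hSm : Measurable S := hS.mono hm le_rfl
  have hwm : Measurable w := hw.mono hm le_rfl
  have hXm : Measurable X :=
    Real.measurable_exp.comp ((((measurable_hit v).comp hξ).sub_const p).const_mul r)
  have hSb : ∀ ω, Real.exp (r * S ω) ≤ Real.exp (|r| * B) := fun ω => by
    refine Real.exp_le_exp.2 ((le_abs_self _).trans ?_)
    rw [abs_mul]
    exact mul_le_mul_of_nonneg_left (hB ω) (abs_nonneg r)
  have hEm : Measurable fun ω => Real.exp (r * S ω) := Real.measurable_exp.comp (hSm.const_mul r)
  have hw0 : ∀ ω, 0 ≤ w ω ∧ w ω ≤ 1 := fun ω => by rcases hw01 ω with h | h <;> simp [h]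
  have hX_int : Integrable X μ := by
    refine Integrable.of_bound hXm.aestronglyMeasurable (Real.exp (|r| * (1 + |p|)))
      (Filter.Eventually.of_forall fun ω => ?_)
    rw [Real.norm_eq_abs, abs_of_pos (Real.exp_pos _)]
    refine Real.exp_le_exp.2 ((le_abs_self _).trans ?_)
    rw [abs_mul]
    refine mul_le_mul_of_nonneg_left ((abs_sub _ _).trans ?_) (abs_nonneg r)
    rw [abs_of_nonneg (hit_nonneg _ _)]
    linarith [hit_le_one v (ξ ω)]
  have hf_int : Integrable (fun ω => Real.exp (r * S ω) * w ω) μ := by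
    refine Integrable.of_bound (hEm.mul hwm).aestronglyMeasurable (Real.exp (|r| * B))
      (Filter.Eventually.of_forall fun ω => ?_)
    rw [Real.norm_eq_abs, abs_of_nonneg (mul_nonneg (Real.exp_pos _).le (hw0 ω).1)]
    nlinarith [hSb ω, Real.exp_pos (r * S ω), (hw0 ω).2]
  have hE_int : Integrable (fun ω => Real.exp (r * S ω)) μ := by
    refine Integrable.of_bound hEm.aestronglyMeasurable (Real.exp (|r| * B))
      (Filter.Eventually.of_forall fun ω => ?_)
    rw [Real.norm_eq_abs, abs_of_pos (Real.exp_pos _)]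
    exact hSb ω
  have hindep : IndepFun (fun ω => Real.exp (r * S ω) * w ω) X μ := by
    rw [IndepFun_iff_Indep]
    refine indep_of_indep_of_le_left (indep_of_indep_of_le_right hind ?_) ?_
    · rintro _ ⟨s, hs, rfl⟩
      exact ⟨{z | Real.exp (r * (hit v z - p)) ∈ s}, trivial, rfl⟩
    · exact ((Real.measurable_exp.comp (hS.const_mul r)).mul hw).comap_le
  have hprod_int : Integrable (fun ω => Real.exp (r * S ω) * w ω * X ω) μ :=
    hindep.integrable_mul hf_int hX_int
  have hsplit : ∀ ω, Real.exp (r * (S ω + w ω * (hit v (ξ ω) - p)))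
      = Real.exp (r * S ω) * w ω * X ω + (Real.exp (r * S ω) - Real.exp (r * S ω) * w ω) := by
    intro ω
    rcases hw01 ω with h | h
    · simp [h]
    · simp only [h, hX, one_mul, mul_one, sub_self, add_zero]
      rw [← Real.exp_add]
      congr 1
      ring
  have hmul := hindep.integral_fun_mul_eq_mul_integral hf_int.aestronglyMeasurable
    hX_int.aestronglyMeasurable
  have hsub_int : Integrable
      (fun ω => Real.exp (r * S ω) - Real.exp (r * S ω) * w ω) μ := hE_int.sub hf_int
  simp_rw [hsplit]
  rw [integral_add hprod_int hsub_int, integral_sub hE_int hf_int, hmul]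
  have h1 : 0 ≤ ∫ ω, Real.exp (r * S ω) * w ω ∂μ :=
    integral_nonneg fun ω => mul_nonneg (Real.exp_pos _).le (hw0 ω).1
  have h2 : ∫ ω, Real.exp (r * S ω) * w ω ∂μ ≤ ∫ ω, Real.exp (r * S ω) ∂μ :=
    integral_mono hf_int hE_int fun ω => mul_le_of_le_one_right (Real.exp_pos _).le (hw0 ω).2
  have h3 : 1 ≤ Real.exp (r ^ 2 / 8) := Real.one_le_exp (by positivity)
  have h4 : ∫ ω, X ω ∂μ ≤ Real.exp (r ^ 2 / 8) := integral_exp_hit_le hξ v r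
  nlinarith [mul_le_mul_of_nonneg_left h4 h1]

/-- The `σ`-algebra generated by the innovations before time `t`. -/
@[reducible] def past (ξ : ℕ → Ω → ℤ) (t : ℕ) : MeasurableSpace Ω :=
  ⨆ i ∈ Set.Iio t, MeasurableSpace.comap (ξ i) ⊤

lemma past_mono (ξ : ℕ → Ω → ℤ) {s t : ℕ} (h : s ≤ t) : past ξ s ≤ past ξ t :=
  biSup_mono fun _ hi => lt_of_lt_of_le hi h

lemma measurable_past (ξ : ℕ → Ω → ℤ) {i t : ℕ} (h : i < t) : Measurable[past ξ t] (ξ i) :=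
  measurable_iff_comap_le.2 (le_biSup (fun i => MeasurableSpace.comap (ξ i) ⊤) h)

lemma past_le {mΩ : MeasurableSpace Ω} {ξ : ℕ → Ω → ℤ} (hξ : ∀ i, Measurable (ξ i)) (t : ℕ) :
    past ξ t ≤ mΩ :=
  iSup₂_le fun i _ => (hξ i).comap_le

lemma indep_past {mΩ : MeasurableSpace Ω} {μ : Measure Ω} {ξ : ℕ → Ω → ℤ}
    (hξ : ∀ i, Measurable (ξ i)) (hind : iIndepFun ξ μ) (t : ℕ) :
    Indep (past ξ t) (MeasurableSpace.comap (ξ t) ⊤) μ := by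
  have h := indep_iSup_of_disjoint (fun i => (hξ i).comap_le) hind.iIndep
    (S := Set.Iio t) (T := {t}) (by simp)
  rw [iSup_singleton] at h
  exact h

section Sums

variable {mΩ : MeasurableSpace Ω} {μ : Measure Ω} [IsProbabilityMeasure μ] {ξ : ℕ → Ω → ℤ}
  {w : ℕ → Ω → ℝ}

lemma measurable_past_sum (hw : ∀ j, Measurable[past ξ j] (w j)) (v : ℤ) (p : ℕ → ℝ) (s t : ℕ) :
    Measurable[past ξ t] fun ω => ∑ j ∈ Finset.Ico s t, w j ω * (hit v (ξ j ω) - p j) := by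
  refine Finset.measurable_fun_sum _ fun j hj => ?_
  have hj := (Finset.mem_Ico.1 hj).2
  exact ((hw j).mono (past_mono ξ hj.le) le_rfl).mul
    (((measurable_hit v).comp (measurable_past ξ hj)).sub_const _)

lemma abs_sum_hit_le (hw01 : ∀ j ω, w j ω = 0 ∨ w j ω = 1) (v : ℤ) {p : ℕ → ℝ}
    (hp : ∀ j, p j ∈ Set.Icc 0 1) (s t : ℕ) (ω : Ω) :
    |∑ j ∈ Finset.Ico s t, w j ω * (hit v (ξ j ω) - p j)| ≤ ((t - s : ℕ) : ℝ) := by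
  refine (Finset.abs_sum_le_sum_abs _ _).trans ((Finset.sum_le_card_nsmul _ _ 1 fun j _ => ?_).trans
    (by simp))
  have h1 := hit_nonneg v (ξ j ω)
  have h2 := hit_le_one v (ξ j ω)
  obtain ⟨h3, h4⟩ := hp j
  rcases hw01 j ω with h | h <;> simp [h]
  exact abs_le.2 ⟨by linarith, by linarith⟩

lemma integral_exp_sum_le (hξ : ∀ i, Measurable (ξ i)) (hind : iIndepFun ξ μ)
    (hw : ∀ j, Measurable[past ξ j] (w j)) (hw01 : ∀ j ω, w j ω = 0 ∨ w j ω = 1) (v : ℤ)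
    (r : ℝ) {s t : ℕ} (hst : s ≤ t) :
    ∫ ω, Real.exp (r * ∑ j ∈ Finset.Ico s t,
        w j ω * (hit v (ξ j ω) - μ.real {ω | ξ j ω = v})) ∂μ
      ≤ Real.exp (r ^ 2 / 8 * ((t : ℝ) - s)) := by
  induction t, hst using Nat.le_induction with
  | base => simp
  | succ t hst ih =>
    simp_rw [Finset.sum_Ico_succ_top hst]
    refine (integral_exp_add_le (past_le hξ t) (hξ t) (indep_past hξ hind t)
      (measurable_past_sum hw v _ s t) (hw t) (hw01 t)
      (abs_sum_hit_le hw01 v (fun j => ⟨measureReal_nonneg, measureReal_le_one⟩) s t) v r).trans ?_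
    refine (mul_le_mul_of_nonneg_left ih (Real.exp_pos _).le).trans ?_
    rw [← Real.exp_add]
    refine Real.exp_le_exp.2 (le_of_eq ?_)
    push_cast
    ring

lemma measureReal_sum_sq_gt_le (hξ : ∀ i, Measurable (ξ i)) (hind : iIndepFun ξ μ)
    (hw : ∀ j, Measurable[past ξ j] (w j)) (hw01 : ∀ j ω, w j ω = 0 ∨ w j ω = 1) (v : ℤ)
    {x : ℝ} (hx : 0 ≤ x) {s t : ℕ} (hst : s < t) :
    μ.real {ω | x * ((t : ℝ) - s) < (∑ j ∈ Finset.Ico s t,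
        w j ω * (hit v (ξ j ω) - μ.real {ω | ξ j ω = v})) ^ 2} ≤ 2 * Real.exp (-(2 * x)) := by
  set S : Ω → ℝ := fun ω => ∑ j ∈ Finset.Ico s t,
    w j ω * (hit v (ξ j ω) - μ.real {ω | ξ j ω = v}) with hS
  have hk : (0 : ℝ) < (t : ℝ) - s := sub_pos.2 (by exact_mod_cast hst)
  set k : ℝ := (t : ℝ) - s
  set ε := √(x * k)
  have hε : ε * ε = x * k := Real.mul_self_sqrt (by positivity)
  have tail : ∀ σ : ℝ, σ ^ 2 = 1 → μ.real {ω | ε ≤ σ * S ω} ≤ Real.exp (-(2 * x)) := by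
    intro σ hσ
    -- The parameter `4 ε / k` is the Chernoff optimum: with `ε² = x k` the exponent is `2 x - 4 x =
    -- -2 x`.
    have hint : Integrable (fun ω => Real.exp (4 * ε / k * σ * S ω)) μ := by
      refine Integrable.of_bound (Real.measurable_exp.comp
        ((((measurable_past_sum hw v _ s t).mono (past_le hξ t) le_rfl)).const_mul
          _)).aestronglyMeasurable (Real.exp (|4 * ε / k * σ| * ((t - s : ℕ) : ℝ)))
        (Filter.Eventually.of_forall fun ω => ?_)
      rw [Real.norm_eq_abs, Real.abs_exp]
      refine Real.exp_le_exp.2 ((le_abs_self _).trans ?_)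
      rw [abs_mul]
      exact mul_le_mul_of_nonneg_left (abs_sum_hit_le hw01 v
        (fun j => ⟨measureReal_nonneg, measureReal_le_one⟩) s t ω) (abs_nonneg _)
    have h1 := mul_meas_ge_le_integral_of_nonneg
      (Filter.Eventually.of_forall fun ω => (Real.exp_pos _).le) hint (Real.exp (4 * ε / k * ε))
    have h2 := integral_exp_sum_le hξ hind hw hw01 v (4 * ε / k * σ) hst.le
    have h3 : {ω | ε ≤ σ * S ω}
        ⊆ {ω | Real.exp (4 * ε / k * ε) ≤ Real.exp (4 * ε / k * σ * S ω)} := fun ω hω => by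
      refine Real.exp_le_exp.2 ?_
      rw [mul_assoc _ σ]
      exact mul_le_mul_of_nonneg_left hω (by positivity)
    have h4 : (4 * ε / k * σ) ^ 2 / 8 * k = 2 * x := by
      have : (4 * ε / k * σ) ^ 2 / 8 * k = 2 * (ε * ε) / k * σ ^ 2 := by field_simp; ring
      rw [this, hσ, hε]
      field_simp
    have h5 : 4 * ε / k * ε = 4 * x := by
      have : 4 * ε / k * ε = 4 * (ε * ε) / k := by ring
      rw [this, hε]
      field_simp
    rw [h4] at h2
    rw [h5] at h1 h3
    have h6 : Real.exp (-(2 * x)) * Real.exp (4 * x) = Real.exp (2 * x) := by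
      rw [← Real.exp_add]; congr 1; ring
    refine (measureReal_mono h3).trans (le_of_mul_le_mul_left ?_ (Real.exp_pos (4 * x)))
    rw [mul_comm (Real.exp (4 * x)) (Real.exp _), h6]
    exact h1.trans h2
  have hsub : {ω | x * k < S ω ^ 2} ⊆ {ω | ε ≤ 1 * S ω} ∪ {ω | ε ≤ -1 * S ω} := by
    intro ω hω
    have h : ε < |S ω| := by
      rw [← Real.sqrt_sq_eq_abs]
      exact Real.sqrt_lt_sqrt (by positivity) hω
    rcases lt_abs.1 h with h | h
    · left; simpa using h.le
    · right; simpa using h.le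
  calc μ.real {ω | x * k < S ω ^ 2} ≤ _ := measureReal_mono hsub
    _ ≤ _ := measureReal_union_le _ _
    _ ≤ _ := by linarith [tail 1 (by norm_num), tail (-1) (by norm_num)]

end Sums

end Concentration

/-! ### Typical paths -/

/-- A `0`/`1`-valued path `β` whose upward transitions have rates `ρ ∈ [c, 1 - c]`, up to
fluctuations of squared size `5 ℓ` per step, and which is often at `0` in long windows. -/
structure IsTypicalPath (c ℓ : ℝ) (T : ℕ) (β ρ : ℕ → ℝ) : Prop where
  values : ∀ j, β j = 0 ∨ β j = 1
  rate_mem : ∀ j, ρ j ∈ Set.Icc c (1 - c)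
  noise : ∀ s t, s < t → t ≤ T →
    (∑ j ∈ Finset.Ico s t, (β (j + 1) * (1 - β j) - ρ j * (1 - β j))) ^ 2
      ≤ 5 * ℓ * ((t : ℝ) - s)
  exposure : ∀ s t, s < t → t ≤ T → 320 * ℓ ≤ c ^ 4 * ((t : ℝ) - s) →
    c * ((t : ℝ) - s) / 4 ≤ ∑ j ∈ Finset.Ico s t, (1 - β j)

/-- The edge process driven by the innovations `ξ` and started at `b`. -/
noncomputable def startedPath {Ω : Type*} (ξ : ℕ → Ω → ℤ) (b : ℝ) : ℕ → Ω → ℝ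
  | 0 => fun _ => b
  | t + 1 => fun ω => startedPath ξ b t ω * hit 0 (ξ t ω) + hit 1 (ξ t ω)

section StartedPath

variable {Ω : Type*} {ξ : ℕ → Ω → ℤ}

lemma measurable_past_startedPath (b : ℝ) (t : ℕ) :
    Measurable[past ξ t] (startedPath ξ b t) := by
  induction t with
  | zero => exact measurable_const
  | succ t ih =>
    have h := measurable_past ξ t.lt_succ_self
    exact ((ih.mono (past_mono ξ t.le_succ) le_rfl).mul ((measurable_hit 0).comp h)).add
      ((measurable_hit 1).comp h)

lemma startedPath_values {b : ℝ} (hb : b = 0 ∨ b = 1) (t : ℕ) (ω : Ω) :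
    startedPath ξ b t ω = 0 ∨ startedPath ξ b t ω = 1 := by
  induction t with
  | zero => exact hb
  | succ t ih =>
    simp only [startedPath, hit]
    split_ifs with h h' <;> simp_all

lemma eq_startedPath {β : ℕ → Ω → ℝ}
    (hβ : ∀ t ω, β (t + 1) ω = β t ω * hit 0 (ξ t ω) + hit 1 (ξ t ω)) (t : ℕ) (ω : Ω) :
    β t ω = startedPath ξ (β 0 ω) t ω := by
  induction t with
  | zero => rfl
  | succ t ih => rw [hβ, ih]; rfl

/-- Outside a small exceptional event the process is a typical path, whatever the dependence
between its initial value and the innovations. -/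
lemma exists_exceptional_set {mΩ : MeasurableSpace Ω} {μ : Measure Ω} [IsProbabilityMeasure μ]
    (hξ : ∀ i, Measurable (ξ i)) (hind : iIndepFun ξ μ) {c ℓ : ℝ} (hc : 0 < c) (hc2 : c < 1 / 2)
    (hℓ : 1 ≤ ℓ) (T : ℕ) {ρ : ℕ → ℝ} (hρ : ∀ j, μ.real {ω | ξ j ω = 1} = ρ j)
    (hρc : ∀ j, ρ j ∈ Set.Icc c (1 - c)) (hneg : ∀ j, c ≤ μ.real {ω | ξ j ω = -1})
    {β : ℕ → Ω → ℝ} (hβ0 : ∀ ω, β 0 ω = 0 ∨ β 0 ω = 1)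
    (hβ : ∀ t ω, β (t + 1) ω = β t ω * hit 0 (ξ t ω) + hit 1 (ξ t ω)) :
    ∃ bad : Set Ω, μ.real bad ≤ 6 * ((T : ℝ) + 1) ^ 2 * Real.exp (-(10 * ℓ)) ∧
      ∀ ω ∉ bad, IsTypicalPath c ℓ T (fun j => β j ω) ρ := by
  classical
  -- The initial value may depend on the innovations, so `1 - β j` need not be measurable with
  -- respect to the past. Both deterministic starts are controlled instead, and each outcome follows
  -- one of them. The third family counts the innovations `-1`, for the exposure bound.
  let w : Fin 3 → ℕ → Ω → ℝ :=
    ![fun j ω => 1 - startedPath ξ 0 j ω, fun j ω => 1 - startedPath ξ 1 j ω, fun _ _ => 1]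
  let v : Fin 3 → ℤ := ![1, 1, -1]
  have hw : ∀ i j, Measurable[past ξ j] (w i j) := by
    intro i j
    fin_cases i
    · exact (measurable_past_startedPath 0 j).const_sub 1
    · exact (measurable_past_startedPath 1 j).const_sub 1
    · exact measurable_const
  have hw01 : ∀ i j ω, w i j ω = 0 ∨ w i j ω = 1 := by
    intro i j ω
    fin_cases i
    · rcases startedPath_values (ξ := ξ) (Or.inl rfl : (0 : ℝ) = 0 ∨ (0 : ℝ) = 1) j ω with h | h <;>
        simp [w, h]
    · rcases startedPath_values (ξ := ξ) (Or.inr rfl : (1 : ℝ) = 0 ∨ (1 : ℝ) = 1) j ω with h | h <;>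
        simp [w, h]
    · simp [w]
  let B : Fin 3 × ℕ × ℕ → Set Ω := fun q =>
    {ω | 5 * ℓ * ((q.2.2 : ℝ) - q.2.1) < (∑ j ∈ Finset.Ico q.2.1 q.2.2,
      w q.1 j ω * (hit (v q.1) (ξ j ω) - μ.real {ω | ξ j ω = v q.1})) ^ 2}
  let I : Finset (Fin 3 × ℕ × ℕ) :=
    (Finset.univ ×ˢ Finset.range (T + 1) ×ˢ Finset.range (T + 1)).filter fun q => q.2.1 < q.2.2
  have hI : (I.card : ℝ) ≤ 3 * ((T : ℝ) + 1) ^ 2 := by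
    have h := Finset.card_filter_le
      (Finset.univ ×ˢ Finset.range (T + 1) ×ˢ Finset.range (T + 1) : Finset (Fin 3 × ℕ × ℕ))
      fun q => q.2.1 < q.2.2
    rw [Finset.card_product, Finset.card_product] at h
    simp only [Finset.card_univ, Fintype.card_fin, Finset.card_range] at h
    calc (I.card : ℝ) ≤ ((3 * ((T + 1) * (T + 1)) : ℕ) : ℝ) := by exact_mod_cast h
      _ = _ := by push_cast; ring
  refine ⟨⋃ q ∈ I, B q, ?_, fun ω hω => ?_⟩
  · refine (measureReal_biUnion_finset_le I B).trans ?_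
    refine (Finset.sum_le_card_nsmul I _ (2 * Real.exp (-(10 * ℓ))) fun q hq => ?_).trans ?_
    · have h := measureReal_sum_sq_gt_le (μ := μ) hξ hind (hw q.1) (hw01 q.1) (v q.1)
        (x := 5 * ℓ) (by linarith) (Finset.mem_filter.1 hq).2
      rwa [← mul_assoc, show (2 : ℝ) * 5 = 10 by norm_num] at h
    · rw [nsmul_eq_mul]
      nlinarith [Real.exp_pos (-(10 * ℓ))]
  have hgood : ∀ i s t, s < t → t ≤ T → (∑ j ∈ Finset.Ico s t,
      w i j ω * (hit (v i) (ξ j ω) - μ.real {ω | ξ j ω = v i})) ^ 2 ≤ 5 * ℓ * ((t : ℝ) - s) := by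
    intro i s t hst ht
    by_contra hcon
    refine hω (Set.mem_biUnion (x := (i, s, t)) ?_ (not_le.1 hcon))
    simp only [Finset.coe_filter, Set.mem_ofPred_eq, Finset.mem_product, Finset.mem_univ,
      Finset.mem_range, true_and, I]
    omega
  have hval : ∀ j, β j ω = 0 ∨ β j ω = 1 := fun j => by
    rw [eq_startedPath hβ]
    exact startedPath_values (hβ0 ω) j ω
  have hup : ∀ j, β (j + 1) ω * (1 - β j ω) = (1 - β j ω) * hit 1 (ξ j ω) := fun j => by
    rw [hβ]
    rcases hval j with h | h <;> simp [h]
  have hdown : ∀ j, hit (-1) (ξ j ω) ≤ 1 - β (j + 1) ω := fun j => by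
    rw [hβ]
    simp only [hit]
    rcases hval j with h | h <;> split_ifs <;> simp_all
  refine ⟨hval, hρc, fun s t hst ht => ?_, fun s t hst ht hk => ?_⟩
  · obtain ⟨i, hi⟩ : ∃ i : Fin 3, ∀ j,
        β (j + 1) ω * (1 - β j ω) - ρ j * (1 - β j ω)
          = w i j ω * (hit (v i) (ξ j ω) - μ.real {ω | ξ j ω = v i}) := by
      rcases hβ0 ω with h | h
      · refine ⟨0, fun j => ?_⟩
        rw [hup]
        simp only [w, v, Matrix.cons_val_zero, hρ, eq_startedPath hβ j ω, h]
        ring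
      · refine ⟨1, fun j => ?_⟩
        rw [hup]
        simp only [w, v, Matrix.cons_val_one, Matrix.cons_val_zero, hρ, eq_startedPath hβ j ω, h]
        ring
    simp_rw [hi]
    exact hgood i s t hst ht
  · have hst' : (s : ℝ) < t := by exact_mod_cast hst
    set k : ℝ := (t : ℝ) - s with hkdef
    have hc4 : c ^ 4 ≤ 1 := pow_le_one₀ hc.le (by linarith)
    have hk320 : 320 ≤ k := by nlinarith
    -- An innovation `-1` at step `j` forces `β (j + 1) = 0` from either state. The shift by one
    -- leaves only `k - 1` innovations inside the window, which is harmless since `k ≥ 320`.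
    obtain ⟨t, rfl⟩ : ∃ t', t = t' + 1 := ⟨t - 1, by omega⟩
    push_cast at hkdef
    have hst1 : s < t := by
      have : (s : ℝ) < t := by linarith
      exact_mod_cast this
    have hQ := hgood 2 s t hst1 (by omega)
    simp only [w, v, Matrix.cons_val, one_mul, Finset.sum_sub_distrib] at hQ
    have hq : c * (k - 1) ≤ ∑ j ∈ Finset.Ico s t, μ.real {ω | ξ j ω = -1} := by
      have h := Finset.card_nsmul_le_sum (Finset.Ico s t) (fun j => μ.real {ω | ξ j ω = -1}) c
        fun j _ => hneg j
      rw [nsmul_eq_mul, Nat.card_Ico, Nat.cast_sub hst1.le] at h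
      rwa [show k - 1 = (t : ℝ) - s by linarith, mul_comm]
    have hsum : ∑ j ∈ Finset.Ico s t, hit (-1) (ξ j ω)
        ≤ ∑ j ∈ Finset.Ico s (t + 1), (1 - β j ω) := by
      rw [Finset.sum_eq_sum_Ico_succ_bot (hst1.trans t.lt_succ_self), ← Finset.sum_Ico_add' _ s t 1]
      have h0 : 0 ≤ 1 - β s ω := by rcases hval s with h | h <;> simp [h]
      linarith [Finset.sum_le_sum fun j (_ : j ∈ Finset.Ico s t) => hdown j]
    -- The threshold `320 = 5 * 64` is what makes the squared noise `5 ℓ k` at most `(c k / 8)²`.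
    have hsq : (∑ j ∈ Finset.Ico s t, hit (-1) (ξ j ω)
        - ∑ j ∈ Finset.Ico s t, μ.real {ω | ξ j ω = -1}) ^ 2 ≤ (c * k / 8) ^ 2 := by
      refine hQ.trans ?_
      have h1 : c ^ 4 ≤ c ^ 2 := pow_le_pow_of_le_one hc.le (by linarith) (by norm_num)
      nlinarith [mul_le_mul_of_nonneg_right hk (by linarith : (0 : ℝ) ≤ k),
        mul_le_mul_of_nonneg_right h1 (sq_nonneg k)]
    have habs := abs_le_of_sq_le_sq' hsq (by nlinarith)
    nlinarith [habs.1]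

end StartedPath

/-! ### Windowed rates of a typical path -/

/-- Number of `0 → 1` transitions in the last `k` steps before `t`. -/
noncomputable def upCount (β : ℕ → ℝ) (t k : ℕ) : ℝ :=
  ∑ j ∈ Finset.Ico (t - k) t, β (j + 1) * (1 - β j)

/-- Number of `0 → 0` transitions in the last `k` steps before `t`. -/
noncomputable def stayCount (β : ℕ → ℝ) (t k : ℕ) : ℝ :=
  ∑ j ∈ Finset.Ico (t - k) t, (1 - β (j + 1)) * (1 - β j)

/-- Empirical `0 → 1` transition rate in the last `k` steps before `t`. -/
noncomputable def rate (β : ℕ → ℝ) (t k : ℕ) : ℝ :=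
  upCount β t k / (upCount β t k + stayCount β t k)

/-- Excess loss over the window `u` of the rate estimated over the window `q`. -/
noncomputable def excessLoss (β : ℕ → ℝ) (t u q : ℕ) : ℝ :=
  binLoss (upCount β t u) (stayCount β t u) (rate β t q)
    - binLoss (upCount β t u) (stayCount β t u) (rate β t u)

section Values

variable {β : ℕ → ℝ}

lemma upCount_add_stayCount (β : ℕ → ℝ) (t k : ℕ) :
    upCount β t k + stayCount β t k = ∑ j ∈ Finset.Ico (t - k) t, (1 - β j) := by
  rw [upCount, stayCount, ← Finset.sum_add_distrib]
  exact Finset.sum_congr rfl fun j _ => by ring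

lemma up_term_nonneg (h : ∀ j, β j = 0 ∨ β j = 1) (j : ℕ) : 0 ≤ β (j + 1) * (1 - β j) := by
  rcases h j with h1 | h1 <;> rcases h (j + 1) with h2 | h2 <;> simp [h1, h2]

lemma stay_term_nonneg (h : ∀ j, β j = 0 ∨ β j = 1) (j : ℕ) :
    0 ≤ (1 - β (j + 1)) * (1 - β j) := by
  rcases h j with h1 | h1 <;> rcases h (j + 1) with h2 | h2 <;> simp [h1, h2]

lemma upCount_nonneg (h : ∀ j, β j = 0 ∨ β j = 1) (t k : ℕ) : 0 ≤ upCount β t k :=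
  Finset.sum_nonneg fun j _ => up_term_nonneg h j

lemma stayCount_nonneg (h : ∀ j, β j = 0 ∨ β j = 1) (t k : ℕ) : 0 ≤ stayCount β t k :=
  Finset.sum_nonneg fun j _ => stay_term_nonneg h j

lemma upCount_mono (h : ∀ j, β j = 0 ∨ β j = 1) (t : ℕ) {u q : ℕ} (huq : u ≤ q) :
    upCount β t u ≤ upCount β t q :=
  Finset.sum_le_sum_of_subset_of_nonneg (Finset.Ico_subset_Ico_left (by omega))
    fun j _ _ => up_term_nonneg h j

lemma stayCount_mono (h : ∀ j, β j = 0 ∨ β j = 1) (t : ℕ) {u q : ℕ} (huq : u ≤ q) :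
    stayCount β t u ≤ stayCount β t q :=
  Finset.sum_le_sum_of_subset_of_nonneg (Finset.Ico_subset_Ico_left (by omega))
    fun j _ _ => stay_term_nonneg h j

lemma upCount_add_stayCount_le (h : ∀ j, β j = 0 ∨ β j = 1) (t k : ℕ) :
    upCount β t k + stayCount β t k ≤ k := by
  rw [upCount_add_stayCount]
  refine (Finset.sum_le_card_nsmul _ _ 1 fun j _ => ?_).trans ?_
  · rcases h j with h | h <;> simp [h]
  · rw [Nat.card_Ico, nsmul_eq_mul, mul_one]
    exact_mod_cast (by omega : t - (t - k) ≤ k)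

lemma rate_nonneg (h : ∀ j, β j = 0 ∨ β j = 1) (t k : ℕ) : 0 ≤ rate β t k :=
  (rate_mem (upCount_nonneg h t k) (stayCount_nonneg h t k)).1

lemma rate_le_one (h : ∀ j, β j = 0 ∨ β j = 1) (t k : ℕ) : rate β t k ≤ 1 :=
  (rate_mem (upCount_nonneg h t k) (stayCount_nonneg h t k)).2

lemma rate_sub_sq_le_one (h : ∀ j, β j = 0 ∨ β j = 1) (t k : ℕ) {x : ℝ} (hx : 0 ≤ x)
    (hx1 : x ≤ 1) : (rate β t k - x) ^ 2 ≤ 1 := by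
  rw [sq_le_one_iff_abs_le_one]
  exact abs_le.2 ⟨by linarith [rate_nonneg h t k], by linarith [rate_le_one h t k]⟩

lemma excessLoss_ge (h : ∀ j, β j = 0 ∨ β j = 1) (t : ℕ) {u q : ℕ} (huq : u ≤ q) :
    (upCount β t u + stayCount β t u) * (rate β t q - rate β t u) ^ 2 / 2
      ≤ excessLoss β t u q := by
  have hX := upCount_mono h t huq
  have hY := stayCount_mono h t huq
  have hY0 := stayCount_nonneg h t u
  have hX0 := upCount_nonneg h t u
  refine binLoss_sub_ge hX0 hY0 (rate_nonneg h t q) (rate_le_one h t q) (fun h0 => ?_) fun h0 => ?_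
  · exact div_pos (by linarith) (by linarith)
  · rw [rate, div_lt_one (by linarith)]
    linarith

lemma excessLoss_nonneg (h : ∀ j, β j = 0 ∨ β j = 1) (t : ℕ) {u q : ℕ} (huq : u ≤ q) :
    0 ≤ excessLoss β t u q := by
  refine le_trans ?_ (excessLoss_ge h t huq)
  have := upCount_nonneg h t u
  have := stayCount_nonneg h t u
  positivity

end Values

/-! ### Bias, variance and excess loss on typical paths -/

namespace IsTypicalPath

variable {c ℓ : ℝ} {T : ℕ} {β ρ : ℕ → ℝ}

lemma exposure_window (h : IsTypicalPath c ℓ T β ρ) {t k : ℕ} (hk : 1 ≤ k) (hkt : k ≤ t)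
    (htT : t ≤ T) (hlarge : 320 * ℓ ≤ c ^ 4 * k) :
    c * k / 4 ≤ upCount β t k + stayCount β t k := by
  rw [upCount_add_stayCount]
  have hcast : (t : ℝ) - ((t - k : ℕ) : ℝ) = k := by
    rw [Nat.cast_sub hkt]
    ring
  have := h.exposure (t - k) t (by omega) htT (by rwa [hcast])
  rwa [hcast] at this

lemma noise_window (h : IsTypicalPath c ℓ T β ρ) {t k : ℕ} (hk : 1 ≤ k) (hkt : k ≤ t)
    (htT : t ≤ T) :
    (upCount β t k - ∑ j ∈ Finset.Ico (t - k) t, ρ j * (1 - β j)) ^ 2 ≤ 5 * ℓ * k := by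
  have := h.noise (t - k) t (by omega) htT
  rw [Nat.cast_sub hkt, sub_sub_cancel, Finset.sum_sub_distrib] at this
  exact this

lemma rate_mem_Icc (h : IsTypicalPath c ℓ T β ρ) (hc : 0 < c) {t k : ℕ}
    (hk : 1 ≤ k) (hkt : k ≤ t) (htT : t ≤ T) (hlarge : 320 * ℓ ≤ c ^ 4 * k) :
    rate β t k ∈ Set.Icc (c / 2) (1 - c / 2) := by
  have hD := h.exposure_window hk hkt htT hlarge
  have hk0 : (1 : ℝ) ≤ k := by exact_mod_cast hk
  -- Here the power `c ^ 4` in the threshold is needed: the noise is at most `c² k / 8`, which is `c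
  -- / 2` times the guaranteed exposure `c k / 4`.
  have hsq : (upCount β t k - ∑ j ∈ Finset.Ico (t - k) t, ρ j * (1 - β j)) ^ 2
      ≤ (c ^ 2 * k / 8) ^ 2 := by
    refine (h.noise_window hk hkt htT).trans ?_
    nlinarith [mul_le_mul_of_nonneg_right hlarge (by linarith : (0 : ℝ) ≤ k)]
  obtain ⟨h1, h2⟩ := abs_le_of_sq_le_sq' hsq (by positivity)
  have hw : ∀ j, 0 ≤ 1 - β j := fun j => by rcases h.values j with h | h <;> simp [h]
  have hlo : c * (upCount β t k + stayCount β t k)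
      ≤ ∑ j ∈ Finset.Ico (t - k) t, ρ j * (1 - β j) := by
    rw [upCount_add_stayCount, Finset.mul_sum]
    exact Finset.sum_le_sum fun j _ => mul_le_mul_of_nonneg_right (h.rate_mem j).1 (hw j)
  have hhi : ∑ j ∈ Finset.Ico (t - k) t, ρ j * (1 - β j)
      ≤ (1 - c) * (upCount β t k + stayCount β t k) := by
    rw [upCount_add_stayCount, Finset.mul_sum]
    exact Finset.sum_le_sum fun j _ => mul_le_mul_of_nonneg_right (h.rate_mem j).2 (hw j)
  have hD0 : 0 < upCount β t k + stayCount β t k := lt_of_lt_of_le (by positivity) hD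
  rw [rate]
  constructor
  · rw [le_div_iff₀ hD0]
    nlinarith
  · rw [div_le_iff₀ hD0]
    nlinarith

/-- The error is noise over exposure plus a weighted average of `ρ j - x`. Squaring gives twice `5 ℓ
k / (c k / 4)²`, which is the `160`, and twice the squared bias. -/
lemma rate_sub_sq_le (h : IsTypicalPath c ℓ T β ρ) (hc : 0 < c) {t k : ℕ} (hk : 1 ≤ k)
    (hkt : k ≤ t) (htT : t ≤ T) (hlarge : 320 * ℓ ≤ c ^ 4 * k) {x d : ℝ}
    (hx : ∀ j ∈ Finset.Ico (t - k) t, |ρ j - x| ≤ d) :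
    (rate β t k - x) ^ 2 ≤ 160 / c ^ 2 * (ℓ / k) + 2 * d ^ 2 := by
  have hD := h.exposure_window hk hkt htT hlarge
  have hN := h.noise_window hk hkt htT
  have hk0 : (0 : ℝ) < k := by exact_mod_cast hk
  have hD0 : 0 < upCount β t k + stayCount β t k := lt_of_lt_of_le (by positivity) hD
  set D := upCount β t k + stayCount β t k with hDdef
  set P := ∑ j ∈ Finset.Ico (t - k) t, ρ j * (1 - β j) with hP
  have hbias : |P - x * D| ≤ d * D := by
    rw [hDdef, upCount_add_stayCount, Finset.mul_sum, Finset.mul_sum, hP, ← Finset.sum_sub_distrib]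
    refine (Finset.abs_sum_le_sum_abs _ _).trans (Finset.sum_le_sum fun j hj => ?_)
    have hw : 0 ≤ 1 - β j := by rcases h.values j with h | h <;> simp [h]
    rw [← sub_mul, abs_mul, abs_of_nonneg hw]
    exact mul_le_mul_of_nonneg_right (hx j hj) hw
  have hb2 : (P - x * D) ^ 2 ≤ (d * D) ^ 2 := sq_le_sq' (abs_le.1 hbias).1 (abs_le.1 hbias).2
  have hsplit : rate β t k - x = ((upCount β t k - P) + (P - x * D)) / D := by
    rw [rate, ← hDdef]
    field_simp
    ring
  have hℓ : 0 ≤ ℓ * k := by nlinarith [sq_nonneg (upCount β t k - P)]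
  have hDk : (c * k / 4) ^ 2 ≤ D ^ 2 := pow_le_pow_left₀ (by positivity) hD 2
  rw [hsplit, div_pow, div_le_iff₀ (by positivity)]
  have h1 : 10 * (ℓ * k) = 160 / c ^ 2 * (ℓ / k) * (c * k / 4) ^ 2 := by
    field_simp
    ring
  have h2 : 0 ≤ 160 / c ^ 2 * (ℓ / k) := by
    have : ℓ / k = ℓ * k / k ^ 2 := by field_simp
    rw [this]
    positivity
  nlinarith [mul_le_mul_of_nonneg_left hDk h2, sq_nonneg ((upCount β t k - P) - (P - x * D))]

/-- Windows inside a quasi-stationary stretch have small excess loss on all their subwindows. -/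
lemma excessLoss_le (h : IsTypicalPath c ℓ T β ρ) (hc : 0 < c) (hc1 : c < 1) (hℓ : 1 ≤ ℓ)
    {t u q : ℕ} (hu : 1 ≤ u) (huq : u ≤ q) (hqt : q ≤ t) (htT : t ≤ T) {x d : ℝ}
    (hx : ∀ j ∈ Finset.Ico (t - q) t, |ρ j - x| ≤ d) :
    excessLoss β t u q ≤ 2560 / c ^ 6 * (ℓ + u * d ^ 2) := by
  have hX0 := upCount_nonneg h.values t u
  have hY0 := stayCount_nonneg h.values t u
  have hu0 : (1 : ℝ) ≤ u := by exact_mod_cast hu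
  have huq0 : (u : ℝ) ≤ q := by exact_mod_cast huq
  have hud : 0 ≤ u * d ^ 2 := by positivity
  have hc2 : c ^ 6 ≤ c ^ 2 := pow_le_pow_of_le_one hc.le hc1.le (by norm_num)
  have hc4 : c ^ 6 ≤ c ^ 4 := pow_le_pow_of_le_one hc.le hc1.le (by norm_num)
  have hrew : 2560 / c ^ 6 * (ℓ + u * d ^ 2) = 2560 * (ℓ + u * d ^ 2) / c ^ 6 := by ring
  -- If `q` is short, its rate may lie near or at `0` or `1`, where the quadratic upper bound is
  -- useless; the crude bound `2 q` is then already of order `ℓ`.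
  rcases lt_or_ge (c ^ 4 * q) (320 * ℓ) with hq | hq
  · have h1 := binLoss_rate_le hX0 hY0 (upCount_mono h.values t huq) (stayCount_mono h.values t huq)
      (upCount_add_stayCount_le h.values t q)
    have h2 := binLoss_nonneg hX0 hY0 (rate_nonneg h.values t u) (rate_le_one h.values t u)
    have h3 : 2 * (q : ℝ) ≤ 2560 / c ^ 6 * (ℓ + u * d ^ 2) := by
      rw [hrew, le_div_iff₀ (by positivity)]
      nlinarith [mul_le_mul_of_nonneg_right hc4 (by linarith : (0 : ℝ) ≤ q)]
    rw [← rate] at h1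
    unfold excessLoss
    linarith
  obtain ⟨hr1, hr2⟩ := h.rate_mem_Icc hc (hu.trans huq) hqt htT hq
  have h1 := binLoss_sub_le hX0 hY0 (θ := rate β t q) (by linarith) (by linarith)
  have hvar : c ^ 2 / 4 ≤ rate β t q * (1 - rate β t q) := by nlinarith
  have hE : excessLoss β t u q ≤ u * ((rate β t q - rate β t u) ^ 2 * (4 / c ^ 2)) := by
    refine h1.trans (mul_le_mul (upCount_add_stayCount_le h.values t u) ?_
      (div_nonneg (sq_nonneg _) (le_trans (by positivity) hvar)) (by linarith))
    rw [div_eq_mul_inv]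
    refine mul_le_mul_of_nonneg_left ?_ (sq_nonneg _)
    rw [← inv_div]
    exact inv_anti₀ (by positivity) hvar
  refine hE.trans ?_
  rw [hrew, le_div_iff₀ (by positivity)]
  -- With `u` short, bounding the squared difference by `1` costs `4 u / c²`, which is where `c ^ 6`
  -- comes from. With `u` long, both rates are close to `x`, and this case produces `2560 = 4 *
  -- 640`.
  rcases lt_or_ge (c ^ 4 * u) (320 * ℓ) with hu' | hu'
  · have h2 : (rate β t q - rate β t u) ^ 2 ≤ 1 :=
      rate_sub_sq_le_one h.values t q (rate_nonneg h.values t u) (rate_le_one h.values t u)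
    have h3 : u * ((rate β t q - rate β t u) ^ 2 * (4 / c ^ 2)) * c ^ 6
        = 4 * (c ^ 4 * u) * (rate β t q - rate β t u) ^ 2 := by field_simp
    rw [h3]
    nlinarith [mul_le_mul_of_nonneg_left h2 (by positivity : 0 ≤ 4 * (c ^ 4 * u))]
  · have hxu : ∀ j ∈ Finset.Ico (t - u) t, |ρ j - x| ≤ d := fun j hj =>
      hx j (Finset.Ico_subset_Ico_left (by omega) hj)
    have h2 := h.rate_sub_sq_le hc (hu.trans huq) hqt htT hq hx
    have h3 := h.rate_sub_sq_le hc hu (huq.trans hqt) htT hu' hxu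
    have h4 : ℓ / q ≤ ℓ / u := div_le_div_of_nonneg_left (by linarith) (by linarith) huq0
    have h5 : 160 / c ^ 2 * (ℓ / q) ≤ 160 / c ^ 2 * (ℓ / u) :=
      mul_le_mul_of_nonneg_left h4 (by positivity)
    have h6 : (rate β t q - rate β t u) ^ 2 ≤ 640 / c ^ 2 * (ℓ / u) + 8 * d ^ 2 := by
      have : 640 / c ^ 2 * (ℓ / u) = 4 * (160 / c ^ 2 * (ℓ / u)) := by ring
      rw [this]
      nlinarith [sq_nonneg ((rate β t q - x) + (rate β t u - x))]
    have h7 : u * ((rate β t q - rate β t u) ^ 2 * (4 / c ^ 2)) * c ^ 6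
        = (rate β t q - rate β t u) ^ 2 * (4 * u * c ^ 4) := by field_simp
    have h8 : (640 / c ^ 2 * (ℓ / u) + 8 * d ^ 2) * (4 * u * c ^ 4)
        = 2560 * c ^ 2 * ℓ + 32 * c ^ 4 * (u * d ^ 2) := by field_simp; ring
    have h9 : c ^ 2 ≤ 1 := pow_le_one₀ hc.le hc1.le
    have h10 : c ^ 4 ≤ 1 := pow_le_one₀ hc.le hc1.le
    rw [h7]
    refine (mul_le_mul_of_nonneg_right h6 (by positivity)).trans ?_
    rw [h8]
    nlinarith [mul_le_mul_of_nonneg_right h9 (by linarith : 0 ≤ ℓ),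
      mul_le_mul_of_nonneg_right h10 hud]

/-- Small excess loss on a long quasi-stationary window forces a small error. -/
lemma rate_sub_sq_le_of_excessLoss (h : IsTypicalPath c ℓ T β ρ) (hc : 0 < c) {t k q : ℕ}
    (hk : 1 ≤ k) (hkq : k ≤ q) (hkt : k ≤ t) (htT : t ≤ T) (hlarge : 320 * ℓ ≤ c ^ 4 * k)
    {x d y : ℝ} (hx : ∀ j ∈ Finset.Ico (t - k) t, |ρ j - x| ≤ d)
    (hy : excessLoss β t k q ≤ k * y) :
    (rate β t q - x) ^ 2 ≤ 16 / c * y + 320 / c ^ 2 * (ℓ / k) + 4 * d ^ 2 := by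
  have hD := h.exposure_window hk hkt htT hlarge
  have h1 := excessLoss_ge h.values t hkq
  have h2 := h.rate_sub_sq_le hc hk hkt htT hlarge hx
  have hk0 : (0 : ℝ) < k := by exact_mod_cast hk
  have h3 : (rate β t q - rate β t k) ^ 2 ≤ 8 / c * y := by
    rw [div_mul_eq_mul_div, le_div_iff₀ hc]
    have h4 := mul_le_mul_of_nonneg_right hD (sq_nonneg (rate β t q - rate β t k))
    refine le_of_mul_le_mul_left ?_ hk0
    nlinarith
  have h5 : 16 / c * y = 2 * (8 / c * y) := by ring
  have h6 : 320 / c ^ 2 * (ℓ / k) = 2 * (160 / c ^ 2 * (ℓ / k)) := by ring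
  rw [h5, h6]
  nlinarith [sq_nonneg ((rate β t q - rate β t k) - (rate β t k - x))]

end IsTypicalPath

/-! ### The grid of candidate windows -/

lemma natCast_le_floor_logb {x : ℝ} (hx : 0 < x) (i : ℕ) :
    (i : ℤ) ≤ ⌊Real.logb 2 x⌋ ↔ 2 ^ i ≤ x := by
  rw [Int.le_floor, Int.cast_natCast, Real.le_logb_iff_rpow_le one_lt_two hx, Real.rpow_natCast]

/-- Shifting the index by one removes the truncated `j - 1` and turns the floors of logarithms into
inequalities between natural numbers. -/
lemma mem_grid {t : ℕ} (ht : 2 ≤ t) (k : ℕ) : k ∈ grid t ↔ k = 1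
    ∨ (∃ j, 3 * 2 ^ j ≤ t - 1 ∧ k = gridL t (j + 1))
    ∨ ∃ j, 2 ^ (j + 2) ≤ t - 1 ∧ k = gridR t (j + 1) := by
  have hcast : ((t - 1 : ℕ) : ℝ) = (t : ℝ) - 1 := by
    rw [Nat.cast_sub (by omega), Nat.cast_one]
  have ht0 : (0 : ℝ) < (t : ℝ) - 1 := by
    rw [← hcast]
    exact_mod_cast (by omega : 0 < t - 1)
  have hL : ∀ j : ℕ, j + 1 ∈ Finset.Icc 1 (⌊Real.logb 2 (((t : ℝ) - 1) / 3)⌋ + 1).toNat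
      ↔ 3 * 2 ^ j ≤ t - 1 := by
    intro j
    have h := natCast_le_floor_logb (div_pos ht0 (by norm_num : (0 : ℝ) < 3)) j
    rw [le_div_iff₀ (by norm_num), ← hcast] at h
    have h2 : ((2 : ℝ) ^ j * 3 ≤ ((t - 1 : ℕ) : ℝ)) ↔ 3 * 2 ^ j ≤ t - 1 := by
      rw [mul_comm]
      exact_mod_cast Iff.rfl
    rw [← h2, ← h, ← hcast, Finset.mem_Icc]
    omega
  have hR : ∀ j : ℕ, j + 1 ∈ Finset.Icc 1 (⌊Real.logb 2 ((t : ℝ) - 1)⌋ - 1).toNat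
      ↔ 2 ^ (j + 2) ≤ t - 1 := by
    intro j
    have h := natCast_le_floor_logb ht0 (j + 2)
    rw [← hcast] at h
    have h2 : ((2 : ℝ) ^ (j + 2) ≤ ((t - 1 : ℕ) : ℝ)) ↔ 2 ^ (j + 2) ≤ t - 1 := by
      exact_mod_cast Iff.rfl
    rw [← h2, ← h, ← hcast, Finset.mem_Icc]
    omega
  rw [grid, if_neg (by omega), Finset.mem_union, Finset.mem_union, Finset.mem_singleton,
    Finset.mem_image, Finset.mem_image, or_assoc]
  refine or_congr Iff.rfl (or_congr ⟨?_, ?_⟩ ⟨?_, ?_⟩)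
  · rintro ⟨j, hj, rfl⟩
    obtain ⟨i, rfl⟩ : ∃ i, j = i + 1 := ⟨j - 1, by have := (Finset.mem_Icc.1 hj).1; omega⟩
    exact ⟨i, (hL i).1 hj, rfl⟩
  · rintro ⟨j, hj, rfl⟩
    exact ⟨j + 1, (hL j).2 hj, rfl⟩
  · rintro ⟨j, hj, rfl⟩
    obtain ⟨i, rfl⟩ : ∃ i, j = i + 1 := ⟨j - 1, by have := (Finset.mem_Icc.1 hj).1; omega⟩
    exact ⟨i, (hR i).1 hj, rfl⟩
  · rintro ⟨j, hj, rfl⟩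
    exact ⟨j + 1, (hR j).2 hj, rfl⟩

lemma one_mem_grid (t : ℕ) : 1 ∈ grid t := by
  rcases Nat.lt_or_ge 1 t with ht | ht
  · exact (mem_grid ht 1).2 (Or.inl rfl)
  · simp [grid, ht]

lemma gridL_succ (t j : ℕ) : gridL t (j + 1) = 2 * 2 ^ j + (t - 1) % 2 ^ j := by
  rw [gridL, Nat.add_sub_cancel, pow_succ, mul_comm]

lemma mem_grid_bounds {t k : ℕ} (ht : 1 ≤ t) (hk : k ∈ grid t) : 1 ≤ k ∧ k ≤ t := by
  rcases Nat.lt_or_ge 1 t with ht' | ht'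
  · rcases (mem_grid ht' k).1 hk with rfl | ⟨j, hj, rfl⟩ | ⟨j, hj, rfl⟩
    · omega
    · have h0 := Nat.two_pow_pos j
      have h1 := Nat.mod_lt (t - 1) h0
      rw [gridL_succ]
      omega
    · have h0 := Nat.two_pow_pos j
      have h1 := Nat.mod_lt (t - 1) h0
      rw [pow_add] at hj
      rw [gridR, gridL_succ, Nat.add_sub_cancel]
      omega
  · simp only [grid, ht', if_true, Finset.mem_singleton] at hk
    omega

/-- Every look-back length is matched by a grid window up to a factor `4`. -/
lemma exists_mem_grid {t m : ℕ} (hm : 1 ≤ m) (hmt : m ≤ t) :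
    ∃ k ∈ grid t, 1 ≤ k ∧ k ≤ m ∧ m ≤ 4 * k := by
  rcases Nat.lt_or_ge m 4 with h4 | h4
  · exact ⟨1, one_mem_grid t, le_rfl, hm, by omega⟩
  have hne : (m - 1) / 3 ≠ 0 := by omega
  -- Left grid points suffice: the one of index `j + 1` lies in `[2 * 2^j, 3 * 2^j)`, while this `j`
  -- gives `3 * 2^j < m ≤ 6 * 2^j`.
  set j := Nat.log 2 ((m - 1) / 3)
  have h1 : 2 ^ j ≤ (m - 1) / 3 := Nat.pow_log_le_self 2 hne
  have h2 : (m - 1) / 3 < 2 ^ (j + 1) := Nat.lt_pow_succ_log_self one_lt_two _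
  have h0 := Nat.two_pow_pos j
  have h3 := Nat.mod_lt (t - 1) h0
  rw [pow_succ] at h2
  refine ⟨gridL t (j + 1), (mem_grid (by omega) _).2 (Or.inr (Or.inl ⟨j, by omega, rfl⟩)), ?_⟩
  rw [gridL_succ]
  omega

/-! ### The selected window and the loss in terms of transition counts -/

section Selection

variable {n L : ℕ} {a : ℕ → Edge n L → ℝ}

lemma selectedWindow_spec {tol : ℕ → ℝ} {t k : ℕ} (hk : k ∈ grid t)
    (hpass : ∀ q ∈ grid t, q ≤ k → Passes a tol t q) :
    k ≤ selectedWindow a tol t ∧ selectedWindow a tol t ∈ grid t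
      ∧ Passes a tol t (selectedWindow a tol t) := by
  classical
  have hmem : k ∈ (grid t).filter fun k => ∀ q ∈ grid t, q ≤ k → Passes a tol t q :=
    Finset.mem_filter.2 ⟨hk, hpass⟩
  obtain ⟨i, hi, heq⟩ := Finset.exists_mem_eq_sup _ ⟨k, hmem⟩ id
  have hsel : selectedWindow a tol t = i := by
    rw [selectedWindow]
    convert! heq
  have hle : k ≤ selectedWindow a tol t := by
    rw [hsel, show i = id i from rfl, ← heq]
    exact Finset.le_sup (f := id) hmem
  obtain ⟨hi1, hi2⟩ := Finset.mem_filter.1 hi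
  rw [hsel] at hle ⊢
  exact ⟨hle, hi1, hi2 i hi1 le_rfl⟩

lemma cumulative_sub {f g : ℕ → Edge n L → ℝ} (hf : ∀ t, f (t + 1) = f t + g t) {s t : ℕ}
    (hst : s ≤ t) (e : Edge n L) : f t e - f s e = ∑ j ∈ Finset.Ico s t, g j e := by
  induction t, hst using Nat.le_induction with
  | base => simp
  | succ t hst ih =>
    rw [Finset.sum_Ico_succ_top hst, ← ih, hf, Pi.add_apply]
    ring

lemma thetaHat_eq_rate {t k : ℕ} (hk : k ≤ t) (e : Edge n L) :
    thetaHat a t k e = rate (fun j => a j e) t k := by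
  rw [thetaHat, rate, upCount_add_stayCount, upCount,
    cumulative_sub (g := fun j => a (j + 1) * (1 - a j)) (fun t => rfl) (Nat.sub_le t k) e,
    cumulative_sub (g := a) (fun t => rfl) (Nat.sub_le t k) e, Finset.sum_sub_distrib]
  have hc : ((t - (t - k) : ℕ) : ℝ) = k := by rw [Nat.sub_sub_self hk]
  simp [hc]

/-- Complementing the path exchanges the two transition types, so every result on `rate` also covers
`deltaHat`. -/
lemma deltaHat_eq_rate (t k : ℕ) (e : Edge n L) :
    deltaHat a t k e = rate (fun j => 1 - a j e) t k := by
  rw [deltaHat, rate, upCount_add_stayCount, upCount,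
    cumulative_sub (g := fun j => (1 - a (j + 1)) * a j) (fun t => rfl) (Nat.sub_le t k) e,
    cumulative_sub (g := a) (fun t => rfl) (Nat.sub_le t k) e]
  simp

lemma loss_eq_binLoss (t u : ℕ) (θ δ : Edge n L → ℝ) (e : Edge n L) :
    loss a t u θ δ e = 1 / (u : ℝ) *
      (binLoss (upCount (fun j => a j e) t u) (stayCount (fun j => a j e) t u) (θ e)
        + binLoss (upCount (fun j => 1 - a j e) t u) (stayCount (fun j => 1 - a j e) t u)
          (δ e)) := by
  have hset : Finset.Icc (t - u + 1) t = Finset.Ico (t - u + 1) (t + 1) := by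
    ext
    simp
  rw [loss, hset, ← Finset.sum_Ico_add']
  simp only [Nat.add_sub_cancel, upCount, stayCount, binLoss, Finset.sum_mul]
  rw [← Finset.sum_add_distrib, ← Finset.sum_add_distrib, ← Finset.sum_neg_distrib,
    ← Finset.sum_neg_distrib, ← Finset.sum_add_distrib, neg_mul, ← mul_neg,
    ← Finset.sum_neg_distrib]
  congr 1
  exact Finset.sum_congr rfl fun j _ => by ring

lemma loss_sub_loss {t u q : ℕ} (huq : u ≤ q) (hqt : q ≤ t) (e : Edge n L) :
    loss a t u (thetaHat a t q) (deltaHat a t q) e - loss a t u (thetaHat a t u) (deltaHat a t u) e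
      = 1 / (u : ℝ) *
        (excessLoss (fun j => a j e) t u q + excessLoss (fun j => 1 - a j e) t u q) := by
  rw [loss_eq_binLoss t u, loss_eq_binLoss t u,
    thetaHat_eq_rate hqt, thetaHat_eq_rate (huq.trans hqt), deltaHat_eq_rate, deltaHat_eq_rate,
    excessLoss, excessLoss]
  ring

end Selection

/-! ### The deterministic bound -/

/-- Log-log Lipschitz continuity limits the growth of `V` under division of its argument by at most
`4` to the factor `4 ^ CLip`. -/
lemma IsDriftFunction.le_exp_mul {CLip : ℝ} {V : ℝ → ℝ} (hV : IsDriftFunction CLip V)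
    (hC : 0 ≤ CLip) {k m : ℝ} (hk : 0 < k) (hkm : k ≤ m) (hmk : m ≤ 4 * k) :
    V k ≤ Real.exp (CLip * Real.log 4) * V m := by
  have hm : 0 < m := hk.trans_le hkm
  have h1 := (le_abs_self _).trans (hV.lipschitz k m hk hm)
  have h2 := Real.log_le_log hk hkm
  have h3 := Real.log_le_log hm hmk
  rw [Real.log_mul (by norm_num) hk.ne'] at h3
  rw [abs_sub_comm, abs_of_nonneg (sub_nonneg.2 h2)] at h1
  have h4 : CLip * (Real.log m - Real.log k) ≤ CLip * Real.log 4 :=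
    mul_le_mul_of_nonneg_left (by linarith) hC
  rw [← Real.exp_log (hV.pos k hk), ← Real.exp_log (hV.pos m hm), ← Real.exp_add]
  exact Real.exp_le_exp.2 (by linarith)

/-- The constant in the error bound. -/
noncomputable def errorConst (c CLip Ctau r : ℝ) : ℝ :=
  32 / c * Ctau * (4 + Real.exp (CLip * Real.log 4) ^ 2) + 2560 / (c ^ 4 * r) + 8

/-- On typical paths the selected window balances fluctuations and drift. -/
theorem selected_error_le {c CLip Ctau r ℓ : ℝ} (hc : 0 < c) (hc1 : c < 1) (hCLip : 0 < CLip)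
    (hr : 0 < r) (hr1 : r ≤ 1) (hℓ : 1 ≤ ℓ) (hCtau : 10240 / (c ^ 6 * r) ≤ Ctau)
    {n L T : ℕ} {a : ℕ → Edge n L → ℝ} {V : ℝ → ℝ} (hV : IsDriftFunction CLip V)
    {Θ Δ : ℕ → Edge n L → ℝ} (hlf : r * ℓ ≤ logFactor n L T)
    (hΘ : ∀ e, IsTypicalPath c ℓ T (fun j => a j e) fun j => Θ (j + 1) e)
    (hΔ : ∀ e, IsTypicalPath c ℓ T (fun j => 1 - a j e) fun j => Δ (j + 1) e)
    {t m : ℕ} (hm : 1 ≤ m) (hmt : m ≤ t) (htT : t ≤ T)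
    (hdΘ : ∀ e, ∀ j ∈ Finset.Ico (t - m) t, |Θ (j + 1) e - Θ t e| ≤ V m)
    (hdΔ : ∀ e, ∀ j ∈ Finset.Ico (t - m) t, |Δ (j + 1) e - Δ t e| ≤ V m) (e : Edge n L) :
    (thetaHat a t (selectedWindow a (tolerance Ctau V n L T) t) e - Θ t e) ^ 2
      + (deltaHat a t (selectedWindow a (tolerance Ctau V n L T) t) e - Δ t e) ^ 2
      ≤ errorConst c CLip Ctau r * max (logFactor n L T / m) (V m ^ 2) := by
  have hm0 : (1 : ℝ) ≤ m := by exact_mod_cast hm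
  have hVm : 0 < V m := hV.pos m (by linarith)
  have hCtau0 : 0 < Ctau := lt_of_lt_of_le (by positivity) hCtau
  set tol := tolerance Ctau V n L T with htol
  set lf := logFactor n L T with hlfdef
  have hlf0 : 0 < lf := lt_of_lt_of_le (by positivity) hlf
  have hsub : ∀ {k : ℕ}, k ≤ m → Finset.Ico (t - k) t ⊆ Finset.Ico (t - m) t := fun hk =>
    Finset.Ico_subset_Ico_left (by omega)
  -- The constant `10240` is `2560` from `excessLoss_le`, doubled for the two paths and again for
  -- replacing a sum by a maximum; `1 / r` converts `ℓ` into `logFactor`.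
  have hpass : ∀ q ∈ grid t, q ≤ m → Passes a tol t q := by
    intro q hq hqm u hu huq
    obtain ⟨hu1, -⟩ := mem_grid_bounds (by omega) hu
    have hu0 : (1 : ℝ) ≤ u := by exact_mod_cast hu1
    have hVu : V m ≤ V u := hV.antitone u m (by linarith) (by exact_mod_cast huq.trans hqm)
    have htolu : 10240 / c ^ 6 * max (ℓ / u) (V u ^ 2) ≤ tol u := by
      have h1 : max (ℓ / u) (V u ^ 2) ≤ 1 / r * max ((u : ℝ)⁻¹ * lf) (V u ^ 2) := by
        refine max_le ?_ ?_
        · refine le_trans ?_ (mul_le_mul_of_nonneg_left (le_max_left _ _) (by positivity))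
          have : ℓ ≤ 1 / r * lf := by
            rw [one_div, ← div_eq_inv_mul, le_div_iff₀ hr]
            linarith
          rw [div_eq_inv_mul, mul_left_comm]
          exact mul_le_mul_of_nonneg_left this (by positivity)
        · refine le_trans ?_ (mul_le_mul_of_nonneg_left (le_max_right _ _) (by positivity))
          exact le_mul_of_one_le_left (sq_nonneg _) ((one_le_div hr).2 hr1)
      calc 10240 / c ^ 6 * max (ℓ / u) (V u ^ 2)
          ≤ 10240 / c ^ 6 * (1 / r * max ((u : ℝ)⁻¹ * lf) (V u ^ 2)) :=
            mul_le_mul_of_nonneg_left h1 (by positivity)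
        _ = 10240 / (c ^ 6 * r) * max ((u : ℝ)⁻¹ * lf) (V u ^ 2) := by field_simp
        _ ≤ tol u := mul_le_mul_of_nonneg_right hCtau (le_max_of_le_right (sq_nonneg _))
    refine (pi_norm_le_iff_of_nonneg (le_trans (mul_nonneg (by positivity)
      (le_max_of_le_right (sq_nonneg _))) htolu)).2 fun e => ?_
    have hqt : q ≤ t := hqm.trans hmt
    rw [Pi.sub_apply, loss_sub_loss huq hqt, Real.norm_eq_abs, abs_of_nonneg (mul_nonneg
      (by positivity) (add_nonneg (excessLoss_nonneg (hΘ e).values t huq)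
        (excessLoss_nonneg (hΔ e).values t huq)))]
    have h1 := (hΘ e).excessLoss_le hc hc1 hℓ hu1 huq hqt htT fun j hj => hdΘ e j (hsub hqm hj)
    have h2 := (hΔ e).excessLoss_le hc hc1 hℓ hu1 huq hqt htT fun j hj => hdΔ e j (hsub hqm hj)
    refine le_trans ?_ htolu
    have h3 : 1 / (u : ℝ) * (2 * (2560 / c ^ 6 * (ℓ + u * V m ^ 2)))
        = 5120 / c ^ 6 * (ℓ / u + V m ^ 2) := by field_simp; ring
    calc _ ≤ 1 / (u : ℝ) * (2 * (2560 / c ^ 6 * (ℓ + u * V m ^ 2))) :=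
          mul_le_mul_of_nonneg_left (by linarith) (by positivity)
      _ = 5120 / c ^ 6 * (ℓ / u + V m ^ 2) := h3
      _ ≤ 5120 / c ^ 6 * (2 * max (ℓ / u) (V u ^ 2)) := by
          refine mul_le_mul_of_nonneg_left ?_ (by positivity)
          have := pow_le_pow_left₀ hVm.le hVu 2
          linarith [le_max_left (ℓ / u) (V u ^ 2), le_max_right (ℓ / u) (V u ^ 2)]
      _ = _ := by ring
  obtain ⟨k, hkg, hk1, hkm, hmk⟩ := exists_mem_grid hm hmt
  obtain ⟨hle, hselg, hsel⟩ := selectedWindow_spec hkg fun q hq hqk => hpass q hq (hqk.trans hkm)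
  set kh := selectedWindow a tol t
  have hkht : kh ≤ t := (mem_grid_bounds (by omega) hselg).2
  have hk0 : (1 : ℝ) ≤ k := by exact_mod_cast hk1
  have hkm' : (k : ℝ) ≤ m := by exact_mod_cast hkm
  have hmk' : (m : ℝ) ≤ 4 * k := by exact_mod_cast hmk
  rw [thetaHat_eq_rate hkht, deltaHat_eq_rate]
  set R := max (lf / m) (V m ^ 2) with hR
  have hR1 : lf / m ≤ R := le_max_left _ _
  have hR2 : V m ^ 2 ≤ R := le_max_right _ _
  have hR0 : 0 ≤ R := (sq_nonneg _).trans hR2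
  have hℓm : ℓ / m ≤ R / r := by
    rw [le_div_iff₀ hr]
    refine le_trans (le_of_eq ?_) ((div_le_div_of_nonneg_right hlf (by linarith)).trans hR1)
    ring
  set b := Real.exp (CLip * Real.log 4) with hb
  have hpart : 0 ≤ 32 / c * Ctau * (4 + b ^ 2) * R := by positivity
  have hC : errorConst c CLip Ctau r * R
      = 32 / c * Ctau * (4 + b ^ 2) * R + 2560 / c ^ 4 * (R / r) + 8 * R := by
    rw [errorConst, ← hb]
    field_simp
  rw [hC]
  have hΘt : ∀ {x : ℝ}, x ∈ Set.Icc c (1 - c) → 0 ≤ x ∧ x ≤ 1 := fun h =>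
    ⟨by linarith [h.1], by linarith [h.2]⟩
  have ht1 : t - 1 + 1 = t := by omega
  -- When `k` is short, `m ≤ 4 k` makes `2560 / c ^ 4 * (ℓ / m)` at least `2`, the trivial bound on
  -- the two squared errors.
  rcases lt_or_ge (c ^ 4 * k) (320 * ℓ) with hsmall | hlarge
  · have h1 := hΘt ((hΘ e).rate_mem (t - 1))
    have h2 := hΘt ((hΔ e).rate_mem (t - 1))
    rw [ht1] at h1 h2
    have h3 := rate_sub_sq_le_one (hΘ e).values t kh h1.1 h1.2
    have h4 := rate_sub_sq_le_one (hΔ e).values t kh h2.1 h2.2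
    have h5 : 2 ≤ 2560 / c ^ 4 * (ℓ / m) := by
      rw [div_mul_div_comm, le_div_iff₀ (by positivity)]
      nlinarith [mul_le_mul_of_nonneg_left hmk' (by positivity : 0 ≤ c ^ 4)]
    have h6 := mul_le_mul_of_nonneg_left hℓm (by positivity : 0 ≤ 2560 / c ^ 4)
    linarith
  · have hp := hsel k hkg hle
    -- The test controls only the sum of the two excess losses; as both are nonnegative, each is at
    -- most `k * tol k`.
    have hpe := (norm_le_pi_norm _ e).trans hp
    rw [Pi.sub_apply, loss_sub_loss hle hkht, Real.norm_eq_abs] at hpe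
    have hpe := (le_abs_self _).trans hpe
    have hn1 := excessLoss_nonneg (hΘ e).values t hle
    have hn2 := excessLoss_nonneg (hΔ e).values t hle
    rw [one_div, ← div_eq_inv_mul, div_le_iff₀ (by linarith)] at hpe
    have h1 := (hΘ e).rate_sub_sq_le_of_excessLoss hc hk1 hle (hkm.trans hmt) htT hlarge
      (fun j hj => hdΘ e j (hsub hkm hj)) (y := tol k) (by linarith)
    have h2 := (hΔ e).rate_sub_sq_le_of_excessLoss hc hk1 hle (hkm.trans hmt) htT hlarge
      (fun j hj => hdΔ e j (hsub hkm hj)) (y := tol k) (by linarith)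
    have hinv : (k : ℝ)⁻¹ ≤ 4 * (m : ℝ)⁻¹ := by
      rw [← div_eq_mul_inv, inv_eq_one_div, div_le_div_iff₀ (by linarith) (by linarith)]
      linarith
    have htolk : tol k ≤ Ctau * ((4 + b ^ 2) * R) := by
      refine mul_le_mul_of_nonneg_left (max_le ?_ ?_) hCtau0.le
      · calc (k : ℝ)⁻¹ * lf ≤ 4 * (m : ℝ)⁻¹ * lf := mul_le_mul_of_nonneg_right hinv hlf0.le
          _ = 4 * (lf / m) := by ring
          _ ≤ 4 * R := by linarith
          _ ≤ _ := mul_le_mul_of_nonneg_right (by linarith [sq_nonneg b]) hR0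
      · have h := hV.le_exp_mul hCLip.le (by linarith) hkm' hmk'
        calc V k ^ 2 ≤ (b * V m) ^ 2 := pow_le_pow_left₀ (hV.pos k (by linarith)).le h 2
          _ = b ^ 2 * V m ^ 2 := mul_pow _ _ _
          _ ≤ b ^ 2 * R := mul_le_mul_of_nonneg_left hR2 (sq_nonneg _)
          _ ≤ _ := mul_le_mul_of_nonneg_right (by linarith) hR0
    have h3 := mul_le_mul_of_nonneg_left htolk (by positivity : 0 ≤ 32 / c)
    have h4 : ℓ / k ≤ 4 * (R / r) := by
      calc ℓ / k = (k : ℝ)⁻¹ * ℓ := by ring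
        _ ≤ 4 * (m : ℝ)⁻¹ * ℓ := mul_le_mul_of_nonneg_right hinv (by linarith)
        _ = 4 * (ℓ / m) := by ring
        _ ≤ _ := by linarith
    have h5 : 640 / c ^ 2 * (ℓ / k) ≤ 2560 / c ^ 4 * (R / r) := by
      calc 640 / c ^ 2 * (ℓ / k) ≤ 640 / c ^ 2 * (4 * (R / r)) :=
            mul_le_mul_of_nonneg_left h4 (by positivity)
        _ = 2560 / c ^ 2 * (R / r) := by ring
        _ ≤ _ := mul_le_mul_of_nonneg_right (div_le_div_of_nonneg_left (by norm_num)
            (by positivity) (pow_le_pow_of_le_one hc.le hc1.le (by norm_num))) (by positivity)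
    have h6 : 640 / c ^ 2 * (ℓ / k) = 2 * (320 / c ^ 2 * (ℓ / k)) := by ring
    have h7 : 32 / c * tol k = 2 * (16 / c * tol k) := by ring
    linarith

/-! ### The stochastic block model -/

lemma blockTensor_mem_Icc {n L K : ℕ} {Z : Matrix (Fin n) (Fin K) ℝ} (hZ : IsMembership Z)
    {W : Fin K → Fin K → Fin L → ℝ} {c : ℝ} (hW : ∀ a b l, W a b l ∈ Set.Icc c (1 - c))
    (e : Edge n L) : blockTensor Z W e ∈ Set.Icc c (1 - c) := by
  obtain ⟨p, hp, hpu⟩ := hZ.2 e.1.1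
  obtain ⟨q, hq, hqu⟩ := hZ.2 e.1.2.1
  have h : blockTensor Z W e = W p q e.1.2.2 := by
    rw [blockTensor, Finset.sum_eq_single p, Finset.sum_eq_single q, hp, hq]
    · ring
    · intro b _ hb
      rw [(hZ.1 e.1.2.1 b).resolve_right fun h => hb (hqu b h), mul_zero]
    · simp
    · intro a _ ha
      refine Finset.sum_eq_zero fun b _ => ?_
      rw [(hZ.1 e.1.1 a).resolve_right fun h => ha (hpu a h), zero_mul, zero_mul]
    · simp
  rw [h]
  exact hW _ _ _

lemma card_edge_le (n L : ℕ) : Fintype.card (Edge n L) ≤ n * (n * L) := by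
  refine (Fintype.card_subtype_le _).trans ?_
  simp

section Model

variable {Ω : Type*} [MeasurableSpace Ω] {μ : Measure Ω} [IsProbabilityMeasure μ] {n L K : ℕ}
  {cmin : ℝ} {Z : Matrix (Fin n) (Fin K) ℝ} {W M : ℕ → Fin K → Fin K → Fin L → ℝ}
  {E : ℕ → Edge n L → Ω → ℤ} {A : ℕ → Edge n L → Ω → ℝ}

/-- Outside a small exceptional event an edge and its complement both follow typical paths. -/
lemma IsNonstatARMSBM.exists_exceptional_set_edge (h : IsNonstatARMSBM μ cmin Z W M E A)
    (hc : 0 < cmin) (hc2 : cmin < 1 / 2) {ℓ : ℝ} (hℓ : 1 ≤ ℓ) (T : ℕ) (e : Edge n L) :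
    ∃ bad : Set Ω, μ.real bad ≤ 12 * ((T : ℝ) + 1) ^ 2 * Real.exp (-(10 * ℓ)) ∧
      ∀ ω ∉ bad,
        IsTypicalPath cmin ℓ T (fun j => A j e ω) (fun j => blockTensor Z (W (j + 1)) e) ∧
        IsTypicalPath cmin ℓ T (fun j => 1 - A j e ω) (fun j => blockTensor Z (M (j + 1)) e) := by
  have hmeas : ∀ j, Measurable (E (j + 1) e) := fun j => h.measurable_E _ j.succ_pos e
  have hind : iIndepFun (fun j => E (j + 1) e) μ :=
    h.indep_E.precomp (g := fun j : ℕ => (j, e)) fun i j hij => (Prod.mk.inj hij).1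
  have hW : ∀ j, blockTensor Z (W (j + 1)) e ∈ Set.Icc cmin (1 - cmin) := fun j =>
    blockTensor_mem_Icc h.membership (h.connectivity_W _ j.succ_pos) e
  have hM : ∀ j, blockTensor Z (M (j + 1)) e ∈ Set.Icc cmin (1 - cmin) := fun j =>
    blockTensor_mem_Icc h.membership (h.connectivity_M _ j.succ_pos) e
  have hneg : ∀ (j : ℕ) (z : ℤ), {ω | -E (j + 1) e ω = z} = {ω | E (j + 1) e ω = -z} :=
    fun j z => by
      ext ω
      exact neg_eq_iff_eq_neg
  obtain ⟨B₁, hB₁, hgood₁⟩ := exists_exceptional_set hmeas hind hc hc2 hℓ T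
    (fun j => h.prob_one _ j.succ_pos e) hW
    (fun j => by rw [h.prob_neg_one _ j.succ_pos e]; exact (hM j).1)
    (β := fun j ω => A j e ω) (h.values_A_zero e) fun t ω => h.recursion t e ω
  -- The complement `1 - A` satisfies the same recursion driven by `-E`, with the roles of `W` and
  -- `M` exchanged.
  obtain ⟨B₂, hB₂, hgood₂⟩ := exists_exceptional_set (ξ := fun j ω => -E (j + 1) e ω)
    (fun j => (hmeas j).neg) (hind.comp (fun _ z => -z) fun _ => measurable_neg) hc hc2 hℓ T
    (fun j => by rw [hneg, h.prob_neg_one _ j.succ_pos e]) hM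
    (fun j => by rw [hneg, neg_neg, h.prob_one _ j.succ_pos e]; exact (hW j).1)
    (β := fun j ω => 1 - A j e ω)
    (fun ω => by rcases h.values_A_zero e ω with h | h <;> simp [h])
    fun t ω => by
      rw [h.recursion]
      rcases h.values_E _ t.succ_pos e ω with h | h | h <;> simp [h, hit]
  refine ⟨B₁ ∪ B₂, (measureReal_union_le _ _).trans (by linarith), fun ω hω => ?_⟩
  rw [Set.mem_union, not_or] at hω
  exact ⟨hgood₁ ω hω.1, hgood₂ ω hω.2⟩

/-- Union bound over at most `N ^ 3` edges. At level `ℓ = log N` each costs at most `12 (2 N)² / N ^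
10`, for a total of `48 / N ^ 5`, and `N ≥ 3` absorbs the `48`. -/
lemma IsNonstatARMSBM.exists_exceptional_set (h : IsNonstatARMSBM μ cmin Z W M E A)
    (hc : 0 < cmin) (hc2 : cmin < 1 / 2) {T N : ℕ} (hN : 3 ≤ N) (hnN : n ≤ N) (hLN : L ≤ N)
    (hTN : T ≤ N) (hℓ : 1 ≤ Real.log N) :
    ∃ bad : Set Ω, μ.real bad ≤ (N : ℝ)⁻¹ ∧ ∀ ω ∉ bad, ∀ e,
      IsTypicalPath cmin (Real.log N) T (fun j => A j e ω)
        (fun j => blockTensor Z (W (j + 1)) e) ∧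
      IsTypicalPath cmin (Real.log N) T (fun j => 1 - A j e ω)
        (fun j => blockTensor Z (M (j + 1)) e) := by
  choose B hB hgood using h.exists_exceptional_set_edge hc hc2 hℓ T
  refine ⟨⋃ e, B e, ?_, fun ω hω e => hgood e ω fun hmem => hω (Set.mem_iUnion.2 ⟨e, hmem⟩)⟩
  have hN0 : (3 : ℝ) ≤ N := by exact_mod_cast hN
  have hT : (T : ℝ) ≤ N := by exact_mod_cast hTN
  have hcard : (Fintype.card (Edge n L) : ℝ) ≤ (N : ℝ) ^ 3 := by
    have h1 : Fintype.card (Edge n L) ≤ N ^ 3 := (card_edge_le n L).trans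
      ((Nat.mul_le_mul hnN (Nat.mul_le_mul hnN hLN)).trans_eq (by ring))
    exact_mod_cast h1
  have hexp : Real.exp (-(10 * Real.log N)) = ((N : ℝ) ^ 10)⁻¹ := by
    rw [Real.exp_neg, show (10 : ℝ) * Real.log N = Real.log ((N : ℝ) ^ 10) by
      rw [Real.log_pow]; norm_num, Real.exp_log (by positivity)]
  have hT2 : ((T : ℝ) + 1) ^ 2 ≤ (2 * N) ^ 2 :=
    pow_le_pow_left₀ (by positivity) (by linarith) 2
  calc μ.real (⋃ e, B e) ≤ ∑ e, μ.real (B e) := measureReal_iUnion_fintype_le _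
    _ ≤ ∑ _e : Edge n L, 12 * ((T : ℝ) + 1) ^ 2 * Real.exp (-(10 * Real.log N)) :=
        Finset.sum_le_sum fun e _ => hB e
    _ = Fintype.card (Edge n L) * (12 * ((T : ℝ) + 1) ^ 2 * ((N : ℝ) ^ 10)⁻¹) := by
        rw [Finset.sum_const, Finset.card_univ, nsmul_eq_mul, hexp]
    _ ≤ (N : ℝ) ^ 3 * (12 * (2 * N) ^ 2 * ((N : ℝ) ^ 10)⁻¹) := by
        gcongr
    _ = 48 / N ^ 4 * (N : ℝ)⁻¹ := by
        field_simp
        norm_num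
    _ ≤ 1 * (N : ℝ)⁻¹ := by
        refine mul_le_mul_of_nonneg_right ?_ (by positivity)
        rw [div_le_one (by positivity)]
        calc (48 : ℝ) ≤ 3 ^ 4 := by norm_num
          _ ≤ (N : ℝ) ^ 4 := pow_le_pow_left₀ (by norm_num) hN0 4
    _ = _ := one_mul _

end Model

/-! ### Drift within a segment, up to the current time -/

section Segments

variable {n L T G : ℕ} {cmin CLip : ℝ} {V : ℝ → ℝ} {τ : ℕ → ℕ} {Θ Δ : ℕ → Edge n L → ℝ}

lemma IsQuasiStationary.le_last (h : IsQuasiStationary cmin V T G τ Θ Δ) {g : ℕ} (hg : g ≤ G) :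
    τ g ≤ T := by
  have key : ∀ k, k ≤ G → τ (G - k) ≤ T := by
    intro k
    induction k with
    | zero => intro _; simp [h.last]
    | succ k ih =>
      intro hk
      have h1 := h.lt (G - k) (Finset.mem_Icc.2 ⟨by omega, by omega⟩)
      rw [show G - (k + 1) = G - k - 1 by omega]
      exact h1.le.trans (ih (by omega))
  have := key (G - g) (by omega)
  rwa [Nat.sub_sub_self hg] at this

/-- The segment allows drift `V` of its full length; as `V` is non-increasing, this is at most `V`
of the time elapsed so far, the only length entering the final bound. -/
lemma IsQuasiStationary.abs_sub_le (h : IsQuasiStationary cmin V T G τ Θ Δ)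
    (hV : IsDriftFunction CLip V) {g t j : ℕ} (hg : g ∈ Finset.Icc 1 G)
    (ht : t ∈ Finset.Ioc (τ (g - 1)) (τ g)) (hj : j ∈ Finset.Ico (τ (g - 1)) t) (e : Edge n L) :
    |Θ (j + 1) e - Θ t e| ≤ V ((t : ℝ) - τ (g - 1)) ∧
      |Δ (j + 1) e - Δ t e| ≤ V ((t : ℝ) - τ (g - 1)) := by
  obtain ⟨ht1, ht2⟩ := Finset.mem_Ioc.1 ht
  obtain ⟨hj1, hj2⟩ := Finset.mem_Ico.1 hj
  have hd := h.drift g hg (j + 1) (Finset.mem_Ioc.2 ⟨by omega, by omega⟩) t ht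
  have ht1' : (τ (g - 1) : ℝ) < t := by exact_mod_cast ht1
  have ht2' : (t : ℝ) ≤ τ g := by exact_mod_cast ht2
  have hmono := hV.antitone ((t : ℝ) - τ (g - 1)) ((τ g : ℝ) - τ (g - 1)) (by linarith)
    (by linarith)
  have h1 := norm_le_pi_norm (Θ (j + 1) - Θ t) e
  have h2 := norm_le_pi_norm (Δ (j + 1) - Δ t) e
  rw [Pi.sub_apply, Real.norm_eq_abs] at h1 h2
  constructor
  · linarith [norm_nonneg (Δ (j + 1) - Δ t)]
  · linarith [norm_nonneg (Θ (j + 1) - Θ t)]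

end Segments

lemma one_lt_log_three : 1 < Real.log 3 := by
  rw [Real.lt_log_iff_exp_lt (by norm_num)]
  exact Real.exp_one_lt_d9.trans (by norm_num)

/-- Since `3 > e`, the condition `T ≥ 3` bounds `log log T` below by a positive constant and `log T`
below by `1`, so `logFactor` dominates the noise level `ℓ`. -/
lemma mul_log_le_logFactor {n L T : ℕ} (hT : 3 ≤ T) {r : ℝ} (hr : r ≤ Real.log (Real.log 3))
    (hℓ : 0 ≤ Real.log ((max n (max L T) : ℕ) : ℝ)) :
    r * Real.log ((max n (max L T) : ℕ) : ℝ) ≤ logFactor n L T := by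
  have h1 : Real.log 3 ≤ Real.log T := Real.log_le_log (by norm_num) (by exact_mod_cast hT)
  have h3 := one_lt_log_three
  have h2 : Real.log (Real.log 3) ≤ Real.log (Real.log T) := Real.log_le_log (by linarith) h1
  have h4 : 0 < Real.log (Real.log 3) := Real.log_pos h3
  rw [logFactor, mul_assoc, mul_comm r]
  refine mul_le_mul_of_nonneg_left (hr.trans (h2.trans ?_)) hℓ
  exact le_mul_of_one_le_left (by linarith) (by linarith)

end ARMSBM

/-! ### The main theorem -/

theorem mainTheorem6 (cmin CLip : ℝ) (hcmin : 0 < cmin) (hcmin' : cmin < 1 / 2)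
    (hCLip : 0 < CLip) :
    ∃ C₀ : ℝ, 0 < C₀ ∧ ∀ Ctau : ℝ, C₀ ≤ Ctau → ∃ C c : ℝ, 0 < C ∧ 0 < c ∧
      ∀ (n L K T G : ℕ), 3 ≤ T →
      ∀ (Ω : Type*) [MeasurableSpace Ω] (μ : Measure Ω) [IsProbabilityMeasure μ]
        (Z : Matrix (Fin n) (Fin K) ℝ) (W M : ℕ → Fin K → Fin K → Fin L → ℝ)
        (E : ℕ → ARMSBM.Edge n L → Ω → ℤ) (A : ℕ → ARMSBM.Edge n L → Ω → ℝ)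
        (V : ℝ → ℝ) (τ : ℕ → ℕ),
        ARMSBM.IsNonstatARMSBM μ cmin Z W M E A →
        ARMSBM.IsDriftFunction CLip V →
        ARMSBM.IsQuasiStationary cmin V T G τ
          (fun t => ARMSBM.blockTensor Z (W t)) (fun t => ARMSBM.blockTensor Z (M t)) →
        1 - ((max n (max L T) : ℕ) : ℝ) ^ (-c) ≤
          μ.real {ω | ∀ e : ARMSBM.Edge n L, ∀ g ∈ Finset.Icc 1 G,
            ∀ t ∈ Finset.Ioc (τ (g - 1)) (τ g),
              let a : ℕ → ARMSBM.Edge n L → ℝ := fun s e' => A s e' ω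
              let k := ARMSBM.selectedWindow a (ARMSBM.tolerance Ctau V n L T) t
              |ARMSBM.thetaHat a t k e - ARMSBM.blockTensor Z (W t) e| ^ 2
                  + |ARMSBM.deltaHat a t k e - ARMSBM.blockTensor Z (M t) e| ^ 2
                ≤ C * max (ARMSBM.logFactor n L T / ((t : ℝ) - τ (g - 1)))
                    (V ((t : ℝ) - τ (g - 1)) ^ 2)} := by
  set r : ℝ := min 1 (Real.log (Real.log 3)) with hr
  have hr0 : 0 < r := lt_min one_pos (Real.log_pos ARMSBM.one_lt_log_three)
  refine ⟨10240 / (cmin ^ 6 * r), by positivity, fun Ctau hCtau => ?_⟩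
  have hCtau0 : 0 < Ctau := lt_of_lt_of_le (by positivity) hCtau
  refine ⟨ARMSBM.errorConst cmin CLip Ctau r, 1, ?_, one_pos, ?_⟩
  · unfold ARMSBM.errorConst
    positivity
  intro n L K T G hT Ω _ μ _ Z W M E A V τ hA hV hτ
  set N := max n (max L T) with hN
  have hTN : T ≤ N := (le_max_right _ _).trans (le_max_right _ _)
  have hℓ : 1 ≤ Real.log N := ARMSBM.one_lt_log_three.le.trans
    (Real.log_le_log (by norm_num) (by exact_mod_cast hT.trans hTN))
  obtain ⟨bad, hbad, hgood⟩ := hA.exists_exceptional_set hcmin hcmin' (T := T) (hT.trans hTN)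
    (le_max_left _ _) ((le_max_left _ _).trans (le_max_right _ _)) hTN hℓ
  rw [Real.rpow_neg_one]
  set good : Set Ω := {ω | ∀ e : ARMSBM.Edge n L, ∀ g ∈ Finset.Icc 1 G, _}
  -- Covering the whole space and using subadditivity avoids any measurability claim about `good`.
  have hcover : (Set.univ : Set Ω) ⊆ bad ∪ good := by
    intro ω _
    refine or_iff_not_imp_left.2 fun hω e g hg t ht => ?_
    obtain ⟨ht1, ht2⟩ := Finset.mem_Ioc.1 ht
    have hsub : t - (t - τ (g - 1)) = τ (g - 1) := Nat.sub_sub_self ht1.le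
    have hcast : ((t - τ (g - 1) : ℕ) : ℝ) = (t : ℝ) - τ (g - 1) := Nat.cast_sub ht1.le
    have key := ARMSBM.selected_error_le (a := fun s e' => A s e' ω) hcmin (by linarith) hCLip
      hr0 (min_le_left _ _) hℓ hCtau hV
      (ARMSBM.mul_log_le_logFactor hT (min_le_right _ _) (zero_le_one.trans hℓ))
      (Θ := fun t => ARMSBM.blockTensor Z (W t)) (Δ := fun t => ARMSBM.blockTensor Z (M t))
      (fun e => (hgood ω hω e).1) (fun e => (hgood ω hω e).2)
      (t := t) (m := t - τ (g - 1)) (by omega) (Nat.sub_le _ _)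
      (ht2.trans (hτ.le_last (Finset.mem_Icc.1 hg).2))
      (fun e j hj => by
        rw [hsub] at hj
        rw [hcast]
        exact (hτ.abs_sub_le hV hg ht hj e).1)
      (fun e j hj => by
        rw [hsub] at hj
        rw [hcast]
        exact (hτ.abs_sub_le hV hg ht hj e).2) e
    rw [hcast] at key
    simp only [sq_abs]
    exact key
  have h1 : (1 : ℝ) ≤ μ.real bad + μ.real good := by
    rw [← probReal_univ (μ := μ)]
    exact (measureReal_mono hcover).trans (measureReal_union_le _ _)
  linarith
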